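/- Let $y = X\beta^* + \xi \in \mathbb{R}^n$ with a fixed design $X \in \mathbb{R}^{n\times p}$, where $\beta^*\in\mathbb{R}^p$ has at most $s^*\ge 1$ nonzero entries and $s^* \le s_{\max} \le p/3$. Let $\xi_1,\dots,\xi_n$ be i.i.d. with mean zero, $\Pr(|\xi_i|>t)\le 2\exp\{-t^2/(2\sigma^2)\}$ for all $t\ge 0$, where $\sigma>0$, and $\operatorname{Var}(\xi_i)\ge \kappa\sigma^2$ for a constant $\kappa>0$ ($\kappa=1$ if $\sigma^2$ is the variance). Hard Thresholding Pursuit (HTP) with model size $s$ starts from $\beta^0=0$, $S^0=\emptyset$. Given $\beta^t$, it keeps the $s$ entries of $\beta^t+X^\top(y-X\beta^t)/n$ that are largest in absolute value (ties broken arbitrarily) and sets the others to zero. It lets $S^{t+1}$ be the support of the result, and lets $\beta^{t+1}$ be a minimizer of $\|y-X\beta\|_2$ over the vectors $\beta$ supported on $S^{t+1}$. It stops the first time that $S^{t+1}=S^t$ and returns $\hat\beta^{(s)}=\beta^{t+1}$; if it never stops, $\hat\beta^{(s)}$ is any iterate whose support occurs infinitely often. Put $\mathcal{L}_n(\beta)=\|y-X\beta\|_2^2/(2n)$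 and $$\mathrm{IC}(s)=\log\mathcal{L}_n(\hat\beta^{(s)})+K\frac{s}{n}\log\frac{p}{s}\qquad(\log 0=-\infty),$$ and let $\hat s$ be a minimizer of $\mathrm{IC}$ over $s\in\{1,\dots,s_{\max}\}$. Then for every $\kappa>0$ there are constants $K_0,C_0>0$, depending only on $\kappa$, and for every $K\ge K_0$ there are constants $C_1,C_2,C_3>0$, depending only on $\kappa$ and $K$, with the following property. If $n\ge C_0 s_{\max}\log(p/s_{\max})$ and, for some $\delta<0.3478$, $(1-\delta)\,n\|v\|_2^2\le\|Xv\|_2^2\le(1+\delta)\,n\|v\|_2^2$ for every $v\in\mathbb{R}^p$ with at most $3s^*$ nonzero entries, then with probability at least $1-C_2\exp\{-C_3s^*\log(p/s^*)\}$ both $$\hat s\le 2s^*\qquad\text{and}\qquad \|\hat\beta^{(\hat s)}-\beta^*\|_2\le C_1\sigma\left\{\frac{s^*\log(p/s^*)}{n}\right\}^{1/2}.$$ -/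

import Mathlib

open MeasureTheory ProbabilityTheory Filter
open scoped Matrix

noncomputable section

/-- The Euclidean norm of a real vector given by its coordinates. -/
def l2norm {ι : Type*} [Fintype ι] (v : ι → ℝ) : ℝ :=
  ‖(WithLp.toLp 2 v : EuclideanSpace ℝ ι)‖

/-- The set of indices of the nonzero coordinates. -/
def vecSupport {p : ℕ} (v : Fin p → ℝ) : Finset (Fin p) :=
  Finset.univ.filter fun i => v i ≠ 0

/-- Restricted isometry property of order `k` with constant `δ`, for the scaling `X / √n`:
`(1 - δ) n ‖v‖² ≤ ‖X v‖² ≤ (1 + δ) n ‖v‖²` for every `v` supported on at most `k` indices. -/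
def RIP {n p : ℕ} (X : Matrix (Fin n) (Fin p) ℝ) (k : ℕ) (δ : ℝ) : Prop :=
  ∀ S : Finset (Fin p), S.card ≤ k → ∀ v : Fin p → ℝ, vecSupport v ⊆ S →
    (1 - δ) * (n * l2norm v ^ 2) ≤ l2norm (X *ᵥ v) ^ 2 ∧
      l2norm (X *ᵥ v) ^ 2 ≤ (1 + δ) * (n * l2norm v ^ 2)

/-- `w` is a value of the hard thresholding operator at `v`: it keeps `s` coordinates of `v` that
are largest in absolute value and sets the others to zero (ties may be broken in any way). -/
def IsHardThreshold {p : ℕ} (s : ℕ) (v w : Fin p → ℝ) : Prop :=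
  ∃ A : Finset (Fin p), A.card = min s p ∧ (∀ i ∈ A, ∀ j ∉ A, |v j| ≤ |v i|) ∧
    ∀ i, w i = if i ∈ A then v i else 0

/-- `b` minimizes `‖y - X b‖₂` among the vectors supported on `S`. -/
def IsLeastSquares {n p : ℕ} (X : Matrix (Fin n) (Fin p) ℝ) (y : Fin n → ℝ)
    (S : Finset (Fin p)) (b : Fin p → ℝ) : Prop :=
  vecSupport b ⊆ S ∧
    ∀ b' : Fin p → ℝ, vecSupport b' ⊆ S → l2norm (y - X *ᵥ b) ≤ l2norm (y - X *ᵥ b')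

/-- Supports `S t` and iterates `b t` of Hard Thresholding Pursuit with model size `s`, started
at zero, with the loop continued forever (the stopping rule is in `IsHTPOutput`). -/
structure IsHTPRun {n p : ℕ} (X : Matrix (Fin n) (Fin p) ℝ) (y : Fin n → ℝ) (s : ℕ)
    (S : ℕ → Finset (Fin p)) (b : ℕ → Fin p → ℝ) : Prop where
  support_zero : S 0 = ∅
  iterate_zero : b 0 = 0
  support_succ : ∀ t, ∃ w : Fin p → ℝ,
    IsHardThreshold s (b t + (n : ℝ)⁻¹ • (Xᵀ *ᵥ (y - X *ᵥ b t))) w ∧ S (t + 1) = vecSupport w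
  iterate_succ : ∀ t, IsLeastSquares X y (S (t + 1)) (b (t + 1))

/-- `out` is an output of Hard Thresholding Pursuit with model size `s`. The loop stops the first
time that the support does not change, `S (t + 1) = S t`, and returns `b (t + 1)`. A run may also
cycle through several supports and never stop; then every iterate on the limit cycle, that is,
every iterate whose support is visited infinitely often, is accepted as an output. -/
def IsHTPOutput {n p : ℕ} (X : Matrix (Fin n) (Fin p) ℝ) (y : Fin n → ℝ) (s : ℕ)
    (out : Fin p → ℝ) : Prop :=
  ∃ (S : ℕ → Finset (Fin p)) (b : ℕ → Fin p → ℝ), IsHTPRun X y s S b ∧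
    ((∃ t, S (t + 1) = S t ∧ (∀ u < t, S (u + 1) ≠ S u) ∧ out = b (t + 1)) ∨
      ((∀ t, S (t + 1) ≠ S t) ∧ ∃ t, out = b t ∧ ∃ᶠ u in atTop, S u = S t))

/-- The empirical loss `‖y - X b‖₂² / (2 n)`. -/
def empLoss {n p : ℕ} (X : Matrix (Fin n) (Fin p) ℝ) (y : Fin n → ℝ) (b : Fin p → ℝ) : ℝ :=
  l2norm (y - X *ᵥ b) ^ 2 / (2 * n)

/-- The information criterion `log (loss) + K (s / n) log (p / s)` of an estimate `b` of model size
`s`. It is extended-real valued: the criterion is `-∞` when the loss vanishes. -/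
def infoCrit {n p : ℕ} (X : Matrix (Fin n) (Fin p) ℝ) (y : Fin n → ℝ) (K : ℝ) (s : ℕ)
    (b : Fin p → ℝ) : EReal :=
  ENNReal.log (ENNReal.ofReal (empLoss X y b)) +
    ((K * ((s : ℝ) / n) * Real.log ((p : ℝ) / s) : ℝ) : EReal)

end

/-! ### Euclidean norm and inner product of coordinate vectors -/

section EuclideanNorm

variable {ι : Type*} [Fintype ι]

/-! Write f(s) = s log(p/s). Everything is deterministic on an event where ‖ξ‖² lies between
constant multiples of nσ² and where, for all s* ≤ s ≤ smax and all 3s-sparse v, |⟨ξ, Xv⟩| ≤ R ‖Xv‖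
with R = 32σ√f(s).

At the true size HTP contracts. Hard thresholding of the gradient step misses a part of β* of norm
at most √2(δ‖Δ‖ + ε), where Δ is the current error, and the least-squares refit costs a factor 1/(1
- δ). For δ < 0.3478 the resulting rate is below 0.76. Outputs, even those on a limit cycle, are
thus within 17ε of β*, and their squared residual exceeds ‖ξ‖² by O(σ² f(s*))
(`IsHTPOutput.sq_residual_le`).

Above size 2s* no restricted isometry is needed: completing the square shows that an s-sparse fit
lowers the squared residual below ‖ξ‖² by at most R² (`sq_residual_ge`). Since ‖ξ‖² is at least of
order κnσ², overfitting gains only O(f(s)/n) in log loss, while the penalty grows by at least 0.1 K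
f(s)/n. A large K excludes these sizes.

For ŝ ≤ 2s* the error vector is 3s*-sparse. Comparing the criterion with its value at s* bounds
‖X(β̂ - β*)‖², and the restricted isometry gives the rate. Underfitted models need no separate
argument.

The noise event comes from an exponential moment of projected noise, obtained by Gaussian decoupling
(`lintegral_exp_projection_le`), and a union bound over supports and then over sizes. -/

theorem l2norm_nonneg (v : ι → ℝ) : 0 ≤ l2norm v := norm_nonneg _

theorem l2norm_sq (v : ι → ℝ) : l2norm v ^ 2 = v ⬝ᵥ v := by
  rw [l2norm, EuclideanSpace.norm_sq_eq]
  simp [dotProduct, sq]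

theorem l2norm_add_le (v w : ι → ℝ) : l2norm (v + w) ≤ l2norm v + l2norm w :=
  norm_add_le (WithLp.toLp 2 v : EuclideanSpace ℝ ι) (WithLp.toLp 2 w)

theorem l2norm_neg (v : ι → ℝ) : l2norm (-v) = l2norm v :=
  norm_neg (WithLp.toLp 2 v : EuclideanSpace ℝ ι)

theorem l2norm_eq_zero {v : ι → ℝ} : l2norm v = 0 ↔ v = 0 := by
  simp [l2norm]

theorem abs_dotProduct_le (v w : ι → ℝ) : |v ⬝ᵥ w| ≤ l2norm v * l2norm w := by
  have h := abs_real_inner_le_norm (WithLp.toLp 2 v : EuclideanSpace ℝ ι) (WithLp.toLp 2 w)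
  rwa [EuclideanSpace.inner_toLp_toLp, dotProduct_comm] at h

theorem l2norm_sub_sq (v w : ι → ℝ) :
    l2norm (v - w) ^ 2 = l2norm v ^ 2 - 2 * (v ⬝ᵥ w) + l2norm w ^ 2 := by
  simp only [l2norm_sq, sub_dotProduct, dotProduct_sub, dotProduct_comm w v]
  ring

end EuclideanNorm

/-! ### Supports and coordinate restrictions -/

section Support

variable {p : ℕ}

theorem mem_vecSupport {v : Fin p → ℝ} {i : Fin p} : i ∈ vecSupport v ↔ v i ≠ 0 := by
  simp [vecSupport]

theorem vecSupport_subset_iff {v : Fin p → ℝ} {T : Finset (Fin p)} :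
    vecSupport v ⊆ T ↔ ∀ i, i ∉ T → v i = 0 := by
  simp only [Finset.subset_iff, mem_vecSupport]
  exact forall_congr' fun i => not_imp_comm

theorem vecSupport_add_subset {v w : Fin p → ℝ} {T : Finset (Fin p)}
    (hv : vecSupport v ⊆ T) (hw : vecSupport w ⊆ T) : vecSupport (v + w) ⊆ T := by
  rw [vecSupport_subset_iff] at *
  intro i hi
  simp [hv i hi, hw i hi]

theorem vecSupport_sub_subset {v w : Fin p → ℝ} {T : Finset (Fin p)}
    (hv : vecSupport v ⊆ T) (hw : vecSupport w ⊆ T) : vecSupport (v - w) ⊆ T := by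
  rw [vecSupport_subset_iff] at *
  intro i hi
  simp [hv i hi, hw i hi]

theorem vecSupport_smul_subset {v : Fin p → ℝ} {T : Finset (Fin p)} (a : ℝ)
    (hv : vecSupport v ⊆ T) : vecSupport (a • v) ⊆ T := by
  rw [vecSupport_subset_iff] at *
  intro i hi
  simp [hv i hi]

/-- The vector that agrees with `v` on `T` and vanishes elsewhere. -/
def restrictTo (T : Finset (Fin p)) (v : Fin p → ℝ) : Fin p → ℝ :=
  fun i => if i ∈ T then v i else 0

theorem vecSupport_restrictTo_subset (T : Finset (Fin p)) (v : Fin p → ℝ) :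
    vecSupport (restrictTo T v) ⊆ T := by
  rw [vecSupport_subset_iff]
  intro i hi
  simp [restrictTo, hi]

theorem l2norm_restrictTo_sq (T : Finset (Fin p)) (v : Fin p → ℝ) :
    l2norm (restrictTo T v) ^ 2 = ∑ i ∈ T, v i ^ 2 := by
  rw [l2norm_sq]
  simp [dotProduct, restrictTo, sq]

theorem dotProduct_restrictTo (T : Finset (Fin p)) (v : Fin p → ℝ) :
    v ⬝ᵥ restrictTo T v = l2norm (restrictTo T v) ^ 2 := by
  rw [l2norm_restrictTo_sq]
  simp [dotProduct, restrictTo, sq]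

theorem restrictTo_add_compl (T : Finset (Fin p)) (v : Fin p → ℝ) :
    restrictTo T v + restrictTo Tᶜ v = v := by
  ext i
  by_cases h : i ∈ T <;> simp [restrictTo, h]

end Support

/-! ### Consequences of the restricted isometry property -/

section RestrictedIsometry

variable {n p k : ℕ} {X : Matrix (Fin n) (Fin p) ℝ} {δ : ℝ}

/-- A restricted isometry almost preserves inner products of vectors with a common support. -/
theorem RIP.abs_inner_sub_le (h : RIP X k δ) {T : Finset (Fin p)} (hT : T.card ≤ k)
    {u v : Fin p → ℝ} (hu : vecSupport u ⊆ T) (hv : vecSupport v ⊆ T) :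
    |n * (u ⬝ᵥ v) - (X *ᵥ u) ⬝ᵥ (X *ᵥ v)| ≤ δ * n * (l2norm u * l2norm v) := by
  -- Polarization. Rescaling both vectors to a common norm then turns the sum of squares into a
  -- product.
  have key : ∀ a b : Fin p → ℝ, vecSupport a ⊆ T → vecSupport b ⊆ T →
      2 * (n * (a ⬝ᵥ b) - (X *ᵥ a) ⬝ᵥ (X *ᵥ b)) ≤
        δ * n * (l2norm a ^ 2 + l2norm b ^ 2) := by
    intro a b ha hb
    have h1 := (h T hT (a + b) (vecSupport_add_subset ha hb)).1
    have h2 := (h T hT (a - b) (vecSupport_sub_subset ha hb)).2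
    simp only [l2norm_sq, Matrix.mulVec_add, Matrix.mulVec_sub, add_dotProduct, dotProduct_add,
      sub_dotProduct, dotProduct_sub] at h1 h2 ⊢
    rw [dotProduct_comm b a, dotProduct_comm (X *ᵥ b) (X *ᵥ a)] at h1 h2
    linarith
  have key' : n * (u ⬝ᵥ v) - (X *ᵥ u) ⬝ᵥ (X *ᵥ v) ≤ δ * n * (l2norm u * l2norm v) ∧
      -(n * (u ⬝ᵥ v) - (X *ᵥ u) ⬝ᵥ (X *ᵥ v)) ≤ δ * n * (l2norm u * l2norm v) := by
    rcases (l2norm_nonneg u).eq_or_lt with hu0 | hu0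
    · have := l2norm_eq_zero.1 hu0.symm
      subst this
      simp [← hu0]
    rcases (l2norm_nonneg v).eq_or_lt with hv0 | hv0
    · have := l2norm_eq_zero.1 hv0.symm
      subst this
      simp [← hv0]
    have hpos : 0 < 2 * (l2norm u * l2norm v) := by positivity
    have h1 := key (l2norm v • u) (l2norm u • v) (vecSupport_smul_subset _ hu)
      (vecSupport_smul_subset _ hv)
    have h2 := key (l2norm v • u) (-l2norm u • v) (vecSupport_smul_subset _ hu)
      (vecSupport_smul_subset _ hv)
    simp only [l2norm_sq, Matrix.mulVec_smul, smul_dotProduct, dotProduct_smul, smul_eq_mul]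
      at h1 h2
    simp only [← l2norm_sq] at h1 h2
    constructor
    · refine le_of_mul_le_mul_left ?_ hpos
      linarith
    · refine le_of_mul_le_mul_left ?_ hpos
      linarith
  exact abs_le.2 ⟨by linarith [key'.2], key'.1⟩

theorem RIP.nonneg (h : RIP X k δ) (hk : 1 ≤ k) (hn : 0 < n) (hp : 0 < p) : 0 ≤ δ := by
  have hs : vecSupport (Pi.single (⟨0, hp⟩ : Fin p) (1 : ℝ)) ⊆ {⟨0, hp⟩} := by
    rw [vecSupport_subset_iff]
    intro i hi
    simp only [Finset.mem_singleton] at hi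
    simp [hi]
  obtain ⟨h1, h2⟩ := h {⟨0, hp⟩} (by simpa using hk) _ hs
  have h3 : l2norm (Pi.single (⟨0, hp⟩ : Fin p) (1 : ℝ)) ^ 2 = 1 := by simp [l2norm_sq]
  rw [h3] at h1 h2
  have hn' : (0 : ℝ) < n := by exact_mod_cast hn
  nlinarith

/-- On sparse vectors a design with a restricted isometry constant below `1` is injective. -/
theorem RIP.eq_zero_of_mulVec_eq_zero (h : RIP X k δ) (hδ : δ < 1) (hn : 0 < n)
    {T : Finset (Fin p)} (hT : T.card ≤ k) {u : Fin p → ℝ} (hu : vecSupport u ⊆ T)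
    (hX : X *ᵥ u = 0) : u = 0 := by
  have h1 := (h T hT u hu).1
  have h0 : l2norm (0 : Fin n → ℝ) ^ 2 = 0 := by simp [l2norm_sq]
  rw [hX, h0] at h1
  have hn' : (0 : ℝ) < n := by exact_mod_cast hn
  have hc : 0 < (1 - δ) * n := by nlinarith
  rw [← l2norm_eq_zero]
  have : l2norm u ^ 2 ≤ 0 := by
    refine le_of_mul_le_mul_left ?_ hc
    linarith
  nlinarith [l2norm_nonneg u]

end RestrictedIsometry

/-! ### Least squares on a fixed support -/

section LeastSquares

variable {n p : ℕ} {X : Matrix (Fin n) (Fin p) ℝ} {y : Fin n → ℝ} {S : Finset (Fin p)}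
  {b : Fin p → ℝ}

/-- The normal equations. -/
theorem IsLeastSquares.residual_orthogonal (h : IsLeastSquares X y S b) {u : Fin p → ℝ}
    (hu : vecSupport u ⊆ S) : (y - X *ᵥ b) ⬝ᵥ (X *ᵥ u) = 0 := by
  set a := (y - X *ᵥ b) ⬝ᵥ (X *ᵥ u) with ha
  set c := l2norm (X *ᵥ u) ^ 2 with hc
  have hc0 : 0 ≤ c := sq_nonneg _
  -- The optimal step is `a / c`; the `+ 1` covers `c = 0` and still decreases the residual strictly
  -- unless `a = 0`.
  set t := a / (c + 1) with ht
  have h1 := h.2 (b + t • u) (vecSupport_add_subset h.1 (vecSupport_smul_subset t hu))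
  have h2 : y - X *ᵥ (b + t • u) = (y - X *ᵥ b) - t • (X *ᵥ u) := by
    rw [Matrix.mulVec_add, Matrix.mulVec_smul]
    abel
  rw [h2] at h1
  have h3 := pow_le_pow_left₀ (l2norm_nonneg _) h1 2
  have h4 : l2norm (t • (X *ᵥ u)) ^ 2 = t ^ 2 * c := by
    simp only [hc, l2norm_sq, smul_dotProduct, dotProduct_smul, smul_eq_mul]
    ring
  rw [l2norm_sub_sq (y - X *ᵥ b), h4, dotProduct_smul, smul_eq_mul, ← ha] at h3
  have h5 : a = t * (c + 1) := by rw [ht]; field_simp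
  have h6 : t ^ 2 * (c + 2) ≤ 0 := by
    have : t * a = t ^ 2 * (c + 1) := by rw [h5]; ring
    nlinarith
  have h7 : t ^ 2 = 0 := by nlinarith [sq_nonneg t]
  rw [h5, pow_eq_zero_iff two_ne_zero |>.1 h7, zero_mul]

/-- In an HTP run this makes the iterate a function of its support, so a recurring support means a
recurring iterate. -/
theorem IsLeastSquares.unique {k : ℕ} {δ : ℝ} {b' : Fin p → ℝ} (hX : RIP X k δ) (hδ : δ < 1)
    (hn : 0 < n) (hS : S.card ≤ k) (h : IsLeastSquares X y S b) (h' : IsLeastSquares X y S b') :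
    b = b' := by
  have hu := vecSupport_sub_subset h.1 h'.1
  have h1 := h.residual_orthogonal hu
  have h2 := h'.residual_orthogonal hu
  have h3 : l2norm (X *ᵥ (b - b')) ^ 2 = 0 := by
    rw [l2norm_sq]
    have : X *ᵥ (b - b') = (y - X *ᵥ b') - (y - X *ᵥ b) := by
      rw [Matrix.mulVec_sub]; abel
    nth_rw 1 [this]
    rw [sub_dotProduct, h1, h2, sub_zero]
  have h4 := l2norm_eq_zero.1 (pow_eq_zero_iff two_ne_zero |>.1 h3)
  exact sub_eq_zero.1 (hX.eq_zero_of_mulVec_eq_zero hδ hn hS hu h4)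

end LeastSquares

/-! ### Optimality of hard thresholding -/

section HardThresholding

variable {n p : ℕ}

theorem sum_le_sum_of_card_le_of_forall_le {ι : Type*} {P Q : Finset ι} {f : ι → ℝ}
    (hf : ∀ i, 0 ≤ f i) (hcard : P.card ≤ Q.card) (h : ∀ i ∈ P, ∀ j ∈ Q, f i ≤ f j) :
    ∑ i ∈ P, f i ≤ ∑ j ∈ Q, f j := by
  rcases P.eq_empty_or_nonempty with rfl | hP
  · simpa using Finset.sum_nonneg fun j _ => hf j
  obtain ⟨m, hm, hmax⟩ := P.exists_max_image f hP
  calc ∑ i ∈ P, f i ≤ P.card • f m := Finset.sum_le_card_nsmul _ _ _ hmax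
    _ ≤ Q.card • f m := nsmul_le_nsmul_left (hf m) hcard
    _ ≤ ∑ j ∈ Q, f j := Finset.card_nsmul_le_sum _ _ _ fun j hj => h m hm j hj

/-- Among sets of at most `s` indices, the support of the thresholded vector leaves out
the least energy. -/
theorem IsHardThreshold.sum_sdiff_le {s : ℕ} (hs : s ≤ p) {v w : Fin p → ℝ}
    (h : IsHardThreshold s v w) {B : Finset (Fin p)} (hB : B.card ≤ s) :
    ∑ i ∈ B \ vecSupport w, v i ^ 2 ≤ ∑ i ∈ vecSupport w \ B, v i ^ 2 := by
  obtain ⟨A, hA, hmax, hw⟩ := h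
  rw [min_eq_left hs] at hA
  have hsub : vecSupport w ⊆ A := by
    rw [vecSupport_subset_iff]
    intro i hi
    simp [hw, hi]
  -- The support of `w` can be smaller than the kept set `A`, but only by indices where `v`
  -- vanishes, so either set gives the same sums.
  have hzero : ∀ i ∈ A, i ∉ vecSupport w → v i = 0 := by
    intro i hi hi'
    rw [mem_vecSupport, not_not, hw, if_pos hi] at hi'
    exact hi'
  have h1 : ∑ i ∈ B \ vecSupport w, v i ^ 2 = ∑ i ∈ B \ A, v i ^ 2 := by
    symm
    refine Finset.sum_subset (Finset.sdiff_subset_sdiff le_rfl hsub) fun i hi hi' => ?_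
    rw [Finset.mem_sdiff] at hi hi'
    have : i ∈ A := by tauto
    simp [hzero i this hi.2]
  have h2 : ∑ i ∈ vecSupport w \ B, v i ^ 2 = ∑ i ∈ A \ B, v i ^ 2 := by
    refine Finset.sum_subset (Finset.sdiff_subset_sdiff hsub le_rfl) fun i hi hi' => ?_
    rw [Finset.mem_sdiff] at hi hi'
    have : i ∉ vecSupport w := by tauto
    simp [hzero i hi.1 this]
  rw [h1, h2]
  refine sum_le_sum_of_card_le_of_forall_le (fun i => sq_nonneg _) ?_ fun i hi j hj => ?_
  · rw [Finset.card_sdiff_le_card_sdiff_iff]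
    omega
  · rw [Finset.mem_sdiff] at hi hj
    exact sq_le_sq.2 (hmax j hj.1 i hi.2)

theorem IsHardThreshold.card_vecSupport_le {s : ℕ} {v w : Fin p → ℝ}
    (h : IsHardThreshold s v w) : (vecSupport w).card ≤ s := by
  obtain ⟨A, hA, -, hw⟩ := h
  refine (Finset.card_le_card ?_).trans (hA.le.trans (min_le_left _ _))
  rw [vecSupport_subset_iff]
  intro i hi
  simp [hw, hi]

end HardThresholding

/-! ### Contraction of Hard Thresholding Pursuit -/

section HardThresholdingPursuit

variable {n p s : ℕ} {X : Matrix (Fin n) (Fin p) ℝ} {δ ε : ℝ} {βstar : Fin p → ℝ}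
  {e : Fin n → ℝ}

/-- The gradient step, restricted to a small set, contracts the estimation error. -/
theorem l2norm_restrictTo_gradientStep_le (hX : RIP X (3 * s) δ) (hn : 0 < n)
    (hnoise : ∀ v : Fin p → ℝ, (vecSupport v).card ≤ 3 * s →
      e ⬝ᵥ (X *ᵥ v) ≤ n * (ε * l2norm v))
    {S T : Finset (Fin p)} (hcard : (S ∪ T).card ≤ 3 * s) {b : Fin p → ℝ}
    (hb : vecSupport (b - βstar) ⊆ S) (hε : 0 ≤ ε) (hδ : 0 ≤ δ) :
    l2norm (restrictTo T (b + (n : ℝ)⁻¹ • (Xᵀ *ᵥ (X *ᵥ βstar + e - X *ᵥ b)) - βstar)) ≤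
      δ * l2norm (b - βstar) + ε := by
  have hn' : (0 : ℝ) < n := by exact_mod_cast hn
  set Δ := b - βstar with hΔ
  set r := b + (n : ℝ)⁻¹ • (Xᵀ *ᵥ (X *ᵥ βstar + e - X *ᵥ b)) - βstar with hr
  set u := restrictTo T r with hu
  have hr' : r = Δ + (n : ℝ)⁻¹ • (Xᵀ *ᵥ (e - X *ᵥ Δ)) := by
    have : X *ᵥ βstar + e - X *ᵥ b = e - X *ᵥ Δ := by
      rw [hΔ, Matrix.mulVec_sub]; abel
    rw [hr, this, hΔ]; abel
  have huT : vecSupport u ⊆ T := vecSupport_restrictTo_subset T r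
  have h1 := (abs_le.1 (hX.abs_inner_sub_le hcard (hb.trans Finset.subset_union_left)
    (huT.trans Finset.subset_union_right))).2
  have h2 := hnoise u ((Finset.card_le_card (huT.trans Finset.subset_union_right)).trans hcard)
  -- The gradient step is tested against its own restriction: an isometry defect plus a noise term.
  have h3 : n * l2norm u ^ 2 = (n * (Δ ⬝ᵥ u) - (X *ᵥ Δ) ⬝ᵥ (X *ᵥ u)) + e ⬝ᵥ (X *ᵥ u) := by
    rw [hu, ← dotProduct_restrictTo, ← hu]
    nth_rw 1 [hr']
    rw [add_dotProduct, smul_dotProduct, Matrix.mulVec_transpose, ← Matrix.dotProduct_mulVec,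
      sub_dotProduct e, smul_eq_mul]
    field_simp
    ring
  have h4 : (n * l2norm u) * l2norm u ≤ (n * l2norm u) * (δ * l2norm Δ + ε) := by
    nlinarith
  rcases (l2norm_nonneg u).eq_or_lt with h0 | h0
  · rw [← h0]
    have := l2norm_nonneg Δ
    positivity
  · exact le_of_mul_le_mul_left h4 (by positivity)

/-- The normal equations, tested against the error on `S`, control that part; off `S` the error is
`-βstar`. -/
theorem l2norm_leastSquares_error_le (hX : RIP X (3 * s) δ) (hn : 0 < n)
    (hnoise : ∀ v : Fin p → ℝ, (vecSupport v).card ≤ 3 * s →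
      e ⬝ᵥ (X *ᵥ v) ≤ n * (ε * l2norm v))
    {S T : Finset (Fin p)} (hcard : (S ∪ T).card ≤ 3 * s) {b : Fin p → ℝ}
    (hβ : vecSupport βstar ⊆ T) (hb : IsLeastSquares X (X *ᵥ βstar + e) S b)
    (hε : 0 ≤ ε) (hδ : 0 ≤ δ) :
    (1 - δ) * l2norm (b - βstar) ≤ l2norm (restrictTo Sᶜ βstar) + ε := by
  have hn' : (0 : ℝ) < n := by exact_mod_cast hn
  set Δ := b - βstar with hΔ
  set u := restrictTo S Δ with hu
  have huS : vecSupport u ⊆ S := vecSupport_restrictTo_subset S Δ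
  have hΔs : vecSupport Δ ⊆ S ∪ T := vecSupport_sub_subset
    (hb.1.trans Finset.subset_union_left) (hβ.trans Finset.subset_union_right)
  have h1 := (abs_le.1 (hX.abs_inner_sub_le hcard hΔs (huS.trans Finset.subset_union_left))).2
  have h2 := hnoise u ((Finset.card_le_card (huS.trans Finset.subset_union_left)).trans hcard)
  have h3 := hb.residual_orthogonal huS
  have hres : X *ᵥ βstar + e - X *ᵥ b = e - X *ᵥ Δ := by
    rw [hΔ, Matrix.mulVec_sub]; abel
  rw [hres, sub_dotProduct] at h3
  have h5 : Δ ⬝ᵥ u = l2norm u ^ 2 := dotProduct_restrictTo S Δ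
  rw [h5] at h1
  have h4 : (n * l2norm u) * l2norm u ≤ (n * l2norm u) * (δ * l2norm Δ + ε) := by
    nlinarith
  have h6 : l2norm u ≤ δ * l2norm Δ + ε := by
    rcases (l2norm_nonneg u).eq_or_lt with h0 | h0
    · rw [← h0]
      have := l2norm_nonneg Δ
      positivity
    · exact le_of_mul_le_mul_left h4 (by positivity)
  have h7 : restrictTo Sᶜ Δ = -restrictTo Sᶜ βstar := by
    have := vecSupport_subset_iff.1 hb.1
    ext i
    by_cases hi : i ∈ S
    · simp [restrictTo, hi]
    · simp [restrictTo, hi, hΔ, this i hi]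
  have h8 := l2norm_add_le (restrictTo S Δ) (restrictTo Sᶜ Δ)
  rw [restrictTo_add_compl, h7, l2norm_neg, ← hu] at h8
  linarith

/-- The indices of `βstar` missed by hard thresholding carry little energy. -/
theorem IsHardThreshold.l2norm_missed_le (hs : s ≤ p) {v w : Fin p → ℝ}
    (h : IsHardThreshold s v w) (hβ : (vecSupport βstar).card ≤ s) :
    l2norm (restrictTo (vecSupport w)ᶜ βstar) ≤
      √2 * l2norm (restrictTo (vecSupport w ∪ vecSupport βstar) (v - βstar)) := by
  set S := vecSupport w with hS
  set B := vecSupport βstar with hB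
  set r := v - βstar with hr
  have hsum := h.sum_sdiff_le hs hβ
  have h1 : ∑ i ∈ S \ B, v i ^ 2 = l2norm (restrictTo (S \ B) r) ^ 2 := by
    rw [l2norm_restrictTo_sq]
    refine Finset.sum_congr rfl fun i hi => ?_
    have : βstar i = 0 := by
      have := (Finset.mem_sdiff.1 hi).2
      rwa [hB, mem_vecSupport, not_not] at this
    simp [hr, this]
  rw [h1, ← l2norm_restrictTo_sq] at hsum
  have h2 : l2norm (restrictTo (B \ S) v) ≤ l2norm (restrictTo (S \ B) r) :=
    (sq_le_sq₀ (l2norm_nonneg _) (l2norm_nonneg _)).1 hsum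
  -- The `v` part is exchanged for `S \ B`, where `βstar` vanishes and `v = r`. The two pieces of
  -- `r` have disjoint supports, whence `√2` instead of 2.
  have h3 : restrictTo Sᶜ βstar = restrictTo (B \ S) v + -restrictTo (B \ S) r := by
    ext i
    by_cases hi : i ∈ S
    · simp [restrictTo, hi]
    · by_cases hiB : i ∈ B
      · simp [restrictTo, hi, hiB, hr]
      · have : βstar i = 0 := by rwa [hB, mem_vecSupport, not_not] at hiB
        simp [restrictTo, hi, hiB, this]
  have h4 := l2norm_add_le (restrictTo (B \ S) v) (-restrictTo (B \ S) r)
  rw [← h3, l2norm_neg] at h4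
  have h5 : l2norm (restrictTo (B \ S) r) ^ 2 + l2norm (restrictTo (S \ B) r) ^ 2 ≤
      l2norm (restrictTo (S ∪ B) r) ^ 2 := by
    simp only [l2norm_restrictTo_sq]
    rw [← Finset.sum_union disjoint_sdiff_sdiff]
    refine Finset.sum_le_sum_of_subset_of_nonneg ?_ fun i _ _ => sq_nonneg _
    intro i
    simp only [Finset.mem_union, Finset.mem_sdiff]
    tauto
  have h6 : l2norm (restrictTo Sᶜ βstar) ≤
      l2norm (restrictTo (B \ S) r) + l2norm (restrictTo (S \ B) r) := by linarith
  refine h6.trans (abs_le_of_sq_le_sq' ?_ (mul_nonneg (Real.sqrt_nonneg _) (l2norm_nonneg _))).2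
  rw [mul_pow, Real.sq_sqrt zero_le_two]
  nlinarith [sq_nonneg (l2norm (restrictTo (B \ S) r) - l2norm (restrictTo (S \ B) r))]

variable {S : ℕ → Finset (Fin p)} {b : ℕ → Fin p → ℝ}

theorem IsHTPRun.card_le {y : Fin n → ℝ} (h : IsHTPRun X y s S b) (t : ℕ) : (S t).card ≤ s := by
  cases t with
  | zero => simp [h.support_zero]
  | succ t =>
    obtain ⟨w, hw, hS⟩ := h.support_succ t
    exact hS ▸ hw.card_vecSupport_le

theorem IsHTPRun.vecSupport_subset {y : Fin n → ℝ} (h : IsHTPRun X y s S b) (t : ℕ) :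
    vecSupport (b t) ⊆ S t := by
  cases t with
  | zero => simp [h.support_zero, h.iterate_zero, vecSupport]
  | succ t => exact (h.iterate_succ t).1

/-- Time 0 is included, since only the zero vector is supported on `∅`; a later return to the empty
support is then covered. -/
theorem IsHTPRun.isLeastSquares {y : Fin n → ℝ} (h : IsHTPRun X y s S b) (t : ℕ) :
    IsLeastSquares X y (S t) (b t) := by
  cases t with
  | zero =>
    refine ⟨h.vecSupport_subset 0, fun b' hb' => le_of_eq ?_⟩
    have : b' = 0 := by
      ext i
      rw [vecSupport_subset_iff, h.support_zero] at hb'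
      exact hb' i (by simp)
    rw [this, h.iterate_zero]
  | succ t => exact h.iterate_succ t

theorem IsHTPOutput.exists_isLeastSquares {y : Fin n → ℝ} {out : Fin p → ℝ}
    (h : IsHTPOutput X y s out) :
    ∃ T : Finset (Fin p), T.card ≤ s ∧ IsLeastSquares X y T out := by
  obtain ⟨S, b, hrun, h⟩ := h
  rcases h with ⟨t, -, -, rfl⟩ | ⟨-, t, rfl, -⟩
  · exact ⟨_, hrun.card_le _, hrun.isLeastSquares _⟩
  · exact ⟨_, hrun.card_le _, hrun.isLeastSquares _⟩

/-- One iteration of Hard Thresholding Pursuit contracts the estimation error up to the noise. -/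
theorem IsHTPRun.l2norm_error_succ_le (hX : RIP X (3 * s) δ) (hδ : δ < 0.3478) (hδ0 : 0 ≤ δ)
    (hn : 0 < n) (hs : s ≤ p) (hε : 0 ≤ ε)
    (hnoise : ∀ v : Fin p → ℝ, (vecSupport v).card ≤ 3 * s →
      e ⬝ᵥ (X *ᵥ v) ≤ n * (ε * l2norm v))
    (hβ : (vecSupport βstar).card ≤ s) (h : IsHTPRun X (X *ᵥ βstar + e) s S b) (t : ℕ) :
    l2norm (b (t + 1) - βstar) ≤ 0.76 * l2norm (b t - βstar) + 4 * ε := by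
  obtain ⟨w, hw, hS⟩ := h.support_succ t
  have hSt := h.card_le t
  have hSt' := h.card_le (t + 1)
  have h1 := hw.l2norm_missed_le hs hβ
  rw [← hS] at h1
  have hΔ : vecSupport (b t - βstar) ⊆ S t ∪ vecSupport βstar := vecSupport_sub_subset
    ((h.vecSupport_subset t).trans Finset.subset_union_left) Finset.subset_union_right
  have hcard : ((S t ∪ vecSupport βstar) ∪ (S (t + 1) ∪ vecSupport βstar)).card ≤ 3 * s := by
    have e1 : (S t ∪ vecSupport βstar) ∪ (S (t + 1) ∪ vecSupport βstar) =
        (S t ∪ S (t + 1)) ∪ vecSupport βstar := by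
      ext i; simp only [Finset.mem_union]; tauto
    rw [e1]
    have := Finset.card_union_le (S t ∪ S (t + 1)) (vecSupport βstar)
    have := Finset.card_union_le (S t) (S (t + 1))
    omega
  have h2 := l2norm_restrictTo_gradientStep_le hX hn hnoise hcard hΔ hε hδ0
  have hcard' : (S (t + 1) ∪ vecSupport βstar).card ≤ 3 * s := by
    have := Finset.card_union_le (S (t + 1)) (vecSupport βstar)
    omega
  have h3 := l2norm_leastSquares_error_le hX hn hnoise hcard' le_rfl (h.iterate_succ t) hε hδ0
  -- The constants come from 1.415 · 0.3478 / 0.6522 < 0.76 and 2.415 / 0.6522 < 4.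
  have hsq : √2 ≤ 1.415 := Real.sqrt_le_iff.2 ⟨by norm_num, by norm_num⟩
  have hD := l2norm_nonneg (b t - βstar)
  have hD' := l2norm_nonneg (b (t + 1) - βstar)
  have h4 : l2norm (restrictTo (S (t + 1))ᶜ βstar) ≤ 1.415 * (δ * l2norm (b t - βstar) + ε) :=
    h1.trans (mul_le_mul hsq h2 (l2norm_nonneg _) (by norm_num))
  have h5 : δ * l2norm (b t - βstar) ≤ 0.3478 * l2norm (b t - βstar) :=
    mul_le_mul_of_nonneg_right hδ.le hD
  have h6 : 0.6522 * l2norm (b (t + 1) - βstar) ≤ (1 - δ) * l2norm (b (t + 1) - βstar) :=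
    mul_le_mul_of_nonneg_right (by linarith) hD'
  linarith

/-- Every output of Hard Thresholding Pursuit with the true model size is accurate up to the
noise level. -/
theorem IsHTPOutput.l2norm_error_le (hX : RIP X (3 * s) δ) (hδ : δ < 0.3478) (hδ0 : 0 ≤ δ)
    (hn : 0 < n) (hs : s ≤ p) (hε : 0 ≤ ε)
    (hnoise : ∀ v : Fin p → ℝ, (vecSupport v).card ≤ 3 * s →
      e ⬝ᵥ (X *ᵥ v) ≤ n * (ε * l2norm v))
    (hβ : (vecSupport βstar).card ≤ s) {out : Fin p → ℝ}
    (h : IsHTPOutput X (X *ᵥ βstar + e) s out) :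
    l2norm (out - βstar) ≤ 17 * ε := by
  obtain ⟨S, b, hrun, h⟩ := h
  have hstep := hrun.l2norm_error_succ_le hX hδ hδ0 hn hs hε hnoise hβ
  have huniq : ∀ t u, S t = S u → b t = b u := fun t u htu =>
    (hrun.isLeastSquares t).unique hX (by linarith) hn ((hrun.card_le t).trans (by omega))
      (htu ▸ hrun.isLeastSquares u)
  -- Here 17 > 4 / (1 - 0.76). A stopped run is a fixed point of the recursion; a cycling output
  -- recurs infinitely often, so it obeys the limit of the geometric bounds.
  rcases h with ⟨t, hS, -, rfl⟩ | ⟨-, t, rfl, hfreq⟩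
  · have h1 := hstep t
    rw [huniq _ _ hS] at h1 ⊢
    linarith
  · have hbound : ∀ u, l2norm (b u - βstar) ≤ 0.76 ^ u * l2norm (b 0 - βstar) + 17 * ε := by
      intro u
      induction u with
      | zero => simp only [pow_zero, one_mul]; linarith
      | succ u ih =>
        have := hstep u
        rw [pow_succ]
        linarith
    have hlim : Tendsto (fun u : ℕ => (0.76 : ℝ) ^ u * l2norm (b 0 - βstar) + 17 * ε) atTop
        (nhds (0 * l2norm (b 0 - βstar) + 17 * ε)) :=
      ((tendsto_pow_atTop_nhds_zero_of_lt_one (by norm_num) (by norm_num)).mul_const _).add_const _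
    rw [zero_mul, zero_add] at hlim
    refine ge_of_tendsto_of_frequently hlim (hfreq.mono fun u hu => ?_)
    rw [← huniq u t hu]
    exact hbound u

end HardThresholdingPursuit

/-! ### Exponential moments of one sub-Gaussian error -/

section SubGaussian

variable {Ω : Type*} [MeasurableSpace Ω] {μ : Measure Ω} {ξ : Ω → ℝ} {σ : ℝ}

theorem integrable_of_exp_sq (hσ : 0 < σ) (hξ : Measurable ξ)
    (hint : Integrable (fun ω => Real.exp (ξ ω ^ 2 / (4 * σ ^ 2))) μ) : Integrable ξ μ := by
  refine (hint.const_mul (1 + σ ^ 2)).mono' (by fun_prop) (ae_of_all _ fun ω => ?_)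
  have h1 := Real.add_one_le_exp (ξ ω ^ 2 / (4 * σ ^ 2))
  have h2 : ξ ω ^ 2 = 4 * σ ^ 2 * (ξ ω ^ 2 / (4 * σ ^ 2)) := by field_simp
  set z := ξ ω ^ 2 / (4 * σ ^ 2) with hz
  have hz0 : 0 ≤ z := by positivity
  rw [Real.norm_eq_abs]
  have h3 : |ξ ω| ≤ 1 + σ ^ 2 * z := by
    have := sq_nonneg (|ξ ω| - 2)
    rw [sub_sq, sq_abs] at this
    nlinarith
  nlinarith [sq_nonneg σ]

/-- The linear term is kept exactly so that a zero mean removes it. -/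
theorem Real.exp_le_add_exp_sq (x : ℝ) : Real.exp x ≤ x + Real.exp (x ^ 2) := by
  have h2 := Real.add_one_le_exp (x ^ 2)
  rcases le_or_gt |x| 1 with h | h
  · have h1 := (abs_le.1 (Real.abs_exp_sub_one_sub_id_le h)).2
    linarith
  · rcases lt_abs.1 h with h | h
    · have : Real.exp x ≤ Real.exp (x ^ 2) := Real.exp_le_exp.2 (by nlinarith)
      linarith
    · have : Real.exp x ≤ 1 := Real.exp_le_one_iff.2 (by linarith)
      nlinarith

theorem Real.exp_neg_le_quadratic {x : ℝ} (hx : 0 ≤ x) : Real.exp (-x) ≤ 1 - x + x ^ 2 / 2 := by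
  have h1 := Real.quadratic_le_exp_of_nonneg hx
  have h2 : 0 ≤ 1 - x + x ^ 2 / 2 := by nlinarith [sq_nonneg (x - 1)]
  rw [Real.exp_neg, inv_le_iff_one_le_mul₀ (Real.exp_pos x)]
  nlinarith [mul_le_mul_of_nonneg_left h1 h2, sq_nonneg (x ^ 2)]

variable [IsProbabilityMeasure μ]

/-- Layer cake: the tail `2 exp (-2t)` against the weight `exp t` integrates to 2, and the value 1
at level 0 makes 3. -/
theorem lintegral_exp_sq_le_of_tail (hσ : 0 < σ) (hξ : Measurable ξ)
    (htail : ∀ t : ℝ, 0 ≤ t →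
      μ.real {ω | t < |ξ ω|} ≤ 2 * Real.exp (-(t ^ 2 / (2 * σ ^ 2)))) :
    ∫⁻ ω, ENNReal.ofReal (Real.exp (ξ ω ^ 2 / (4 * σ ^ 2))) ∂μ ≤ 3 := by
  have hlayer := lintegral_comp_eq_lintegral_meas_lt_mul (f := fun ω => ξ ω ^ 2 / (4 * σ ^ 2))
    (g := Real.exp) μ (ae_of_all _ fun ω => by positivity) (by fun_prop)
    (fun t _ => Real.continuous_exp.intervalIntegrable _ _)
    (ae_of_all _ fun t => (Real.exp_pos t).le)
  simp only [integral_exp, Real.exp_zero] at hlayer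
  have htail' : ∀ t ∈ Set.Ioi (0 : ℝ), μ {ω | t < ξ ω ^ 2 / (4 * σ ^ 2)} *
      ENNReal.ofReal (Real.exp t) ≤ ENNReal.ofReal (2 * Real.exp (-t)) := by
    intro t ht
    have ht0 : 0 < t := ht
    have hset : {ω | t < ξ ω ^ 2 / (4 * σ ^ 2)} ⊆ {ω | 2 * σ * √t < |ξ ω|} := by
      intro ω hω
      simp only [Set.mem_ofPred_eq] at hω ⊢
      rw [lt_div_iff₀ (by positivity)] at hω
      refine lt_of_pow_lt_pow_left₀ 2 (abs_nonneg _) ?_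
      rw [sq_abs, mul_pow, mul_pow, Real.sq_sqrt ht0.le]
      linarith
    have h1 := htail (2 * σ * √t) (by positivity)
    have h2 : (2 * σ * √t) ^ 2 / (2 * σ ^ 2) = 2 * t := by
      rw [mul_pow, mul_pow, Real.sq_sqrt ht0.le]
      field_simp
    rw [h2] at h1
    calc μ {ω | t < ξ ω ^ 2 / (4 * σ ^ 2)} * ENNReal.ofReal (Real.exp t)
        ≤ ENNReal.ofReal (2 * Real.exp (-(2 * t))) * ENNReal.ofReal (Real.exp t) := by
          gcongr
          refine (measure_mono hset).trans ?_
          rw [← ofReal_measureReal]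
          exact ENNReal.ofReal_le_ofReal h1
      _ = ENNReal.ofReal (2 * Real.exp (-t)) := by
          rw [← ENNReal.ofReal_mul (by positivity), mul_assoc, ← Real.exp_add]
          ring_nf
  have hbound : ∫⁻ ω, ENNReal.ofReal (Real.exp (ξ ω ^ 2 / (4 * σ ^ 2)) - 1) ∂μ ≤ 2 := by
    rw [hlayer]
    refine (setLIntegral_mono' measurableSet_Ioi htail').trans ?_
    rw [← ofReal_integral_eq_lintegral_ofReal ((integrableOn_exp_neg_Ioi 0).const_mul 2)
      (ae_of_all _ fun t => by positivity), integral_const_mul, integral_exp_neg_Ioi_zero]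
    simp
  calc ∫⁻ ω, ENNReal.ofReal (Real.exp (ξ ω ^ 2 / (4 * σ ^ 2))) ∂μ
      = ∫⁻ ω, (ENNReal.ofReal (Real.exp (ξ ω ^ 2 / (4 * σ ^ 2)) - 1) + 1) ∂μ := by
        refine lintegral_congr fun ω => ?_
        rw [← ENNReal.ofReal_one, ← ENNReal.ofReal_add _ zero_le_one, sub_add_cancel]
        exact sub_nonneg.2 (Real.one_le_exp (by positivity))
    _ = ∫⁻ ω, ENNReal.ofReal (Real.exp (ξ ω ^ 2 / (4 * σ ^ 2)) - 1) ∂μ + 1 := by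
        rw [lintegral_add_right _ measurable_const]
        simp
    _ ≤ 2 + 1 := by gcongr
    _ = 3 := by norm_num

theorem integrable_exp_sq_of_tail (hσ : 0 < σ) (hξ : Measurable ξ)
    (htail : ∀ t : ℝ, 0 ≤ t →
      μ.real {ω | t < |ξ ω|} ≤ 2 * Real.exp (-(t ^ 2 / (2 * σ ^ 2)))) :
    Integrable (fun ω => Real.exp (ξ ω ^ 2 / (4 * σ ^ 2))) μ := by
  refine ⟨by fun_prop, ?_⟩
  rw [hasFiniteIntegral_iff_ofReal (ae_of_all _ fun ω => (Real.exp_pos _).le)]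
  exact (lintegral_exp_sq_le_of_tail hσ hξ htail).trans_lt (by norm_num)

theorem integral_exp_sq_le_of_tail (hσ : 0 < σ) (hξ : Measurable ξ)
    (htail : ∀ t : ℝ, 0 ≤ t →
      μ.real {ω | t < |ξ ω|} ≤ 2 * Real.exp (-(t ^ 2 / (2 * σ ^ 2)))) :
    ∫ ω, Real.exp (ξ ω ^ 2 / (4 * σ ^ 2)) ∂μ ≤ 3 := by
  rw [integral_eq_lintegral_of_nonneg_ae (ae_of_all _ fun ω => (Real.exp_pos _).le)
    (by fun_prop)]
  exact ENNReal.toReal_le_of_le_ofReal (by norm_num)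
    ((lintegral_exp_sq_le_of_tail hσ hξ htail).trans (by norm_num))

theorem integral_exp_mul_le_of_exp_sq (hσ : 0 < σ) (hξ : Measurable ξ)
    (hint : Integrable (fun ω => Real.exp (ξ ω ^ 2 / (4 * σ ^ 2))) μ)
    (hle : ∫ ω, Real.exp (ξ ω ^ 2 / (4 * σ ^ 2)) ∂μ ≤ 3) (hmean : ∫ ω, ξ ω ∂μ = 0) (t : ℝ) :
    Integrable (fun ω => Real.exp (t * ξ ω)) μ ∧
      ∫ ω, Real.exp (t * ξ ω) ∂μ ≤ Real.exp (8 * σ ^ 2 * t ^ 2) := by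
  have hdom : ∀ ω, Real.exp (t * ξ ω) ≤
      Real.exp (σ ^ 2 * t ^ 2) * Real.exp (ξ ω ^ 2 / (4 * σ ^ 2)) := by
    intro ω
    rw [← Real.exp_add, Real.exp_le_exp]
    have h1 : σ ^ 2 * t ^ 2 + ξ ω ^ 2 / (4 * σ ^ 2) - t * ξ ω =
        (σ * t - ξ ω / (2 * σ)) ^ 2 := by
      field_simp
      ring
    nlinarith [sq_nonneg (σ * t - ξ ω / (2 * σ))]
  have hI : Integrable (fun ω => Real.exp (t * ξ ω)) μ := by
    refine (hint.const_mul (Real.exp (σ ^ 2 * t ^ 2))).mono' (by fun_prop)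
      (ae_of_all _ fun ω => ?_)
    rw [Real.norm_eq_abs, Real.abs_exp]
    exact hdom ω
  refine ⟨hI, ?_⟩
  -- For small `t`, the zero mean removes the linear term and convexity bounds `exp ((tξ)²)`. For
  -- large `t`, the pointwise bound `hdom` suffices, the constant 3 being absorbed into the
  -- exponent.
  rcases le_or_gt (4 * σ ^ 2 * t ^ 2) 1 with hτ | hτ
  · set τ := 4 * σ ^ 2 * t ^ 2 with hτdef
    have hτ0 : 0 ≤ τ := by positivity
    have hpt : ∀ ω, Real.exp (t * ξ ω) ≤
        t * ξ ω + ((1 - τ) + τ * Real.exp (ξ ω ^ 2 / (4 * σ ^ 2))) := by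
      intro ω
      have h1 := Real.exp_le_add_exp_sq (t * ξ ω)
      have h2 := convexOn_exp.2 (Set.mem_univ 0) (Set.mem_univ (ξ ω ^ 2 / (4 * σ ^ 2)))
        (sub_nonneg.2 hτ) hτ0 (by ring)
      simp only [smul_eq_mul, mul_zero, zero_add, Real.exp_zero, mul_one] at h2
      have h3 : τ * (ξ ω ^ 2 / (4 * σ ^ 2)) = (t * ξ ω) ^ 2 := by
        rw [hτdef]
        field_simp
      rw [h3] at h2
      linarith
    have hIξ := (integrable_of_exp_sq hσ hξ hint).const_mul t
    have hI' : Integrable (fun ω => (1 - τ) + τ * Real.exp (ξ ω ^ 2 / (4 * σ ^ 2))) μ :=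
      (integrable_const _).add (hint.const_mul τ)
    calc ∫ ω, Real.exp (t * ξ ω) ∂μ
        ≤ ∫ ω, (t * ξ ω + ((1 - τ) + τ * Real.exp (ξ ω ^ 2 / (4 * σ ^ 2)))) ∂μ :=
          integral_mono hI (hIξ.add hI') hpt
      _ = (1 - τ) + τ * ∫ ω, Real.exp (ξ ω ^ 2 / (4 * σ ^ 2)) ∂μ := by
          rw [integral_add hIξ hI',
            integral_add (integrable_const _) (hint.const_mul τ), integral_const_mul,
            integral_const_mul, hmean]
          simp
      _ ≤ 2 * τ + 1 := by nlinarith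
      _ ≤ Real.exp (2 * τ) := Real.add_one_le_exp _
      _ = Real.exp (8 * σ ^ 2 * t ^ 2) := by rw [hτdef]; ring_nf
  · have h3 : (3 : ℝ) ≤ Real.exp (7 * (σ ^ 2 * t ^ 2)) := by
      have := Real.quadratic_le_exp_of_nonneg (x := 7 / 4) (by norm_num)
      have h2 : Real.exp (7 / 4) ≤ Real.exp (7 * (σ ^ 2 * t ^ 2)) :=
        Real.exp_le_exp.2 (by linarith)
      linarith
    calc ∫ ω, Real.exp (t * ξ ω) ∂μ
        ≤ ∫ ω, Real.exp (σ ^ 2 * t ^ 2) * Real.exp (ξ ω ^ 2 / (4 * σ ^ 2)) ∂μ :=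
          integral_mono hI (hint.const_mul _) hdom
      _ = Real.exp (σ ^ 2 * t ^ 2) * ∫ ω, Real.exp (ξ ω ^ 2 / (4 * σ ^ 2)) ∂μ :=
          integral_const_mul _ _
      _ ≤ Real.exp (σ ^ 2 * t ^ 2) * Real.exp (7 * (σ ^ 2 * t ^ 2)) := by
          gcongr
          exact hle.trans h3
      _ = Real.exp (8 * σ ^ 2 * t ^ 2) := by rw [← Real.exp_add]; ring_nf

theorem lintegral_exp_mul_le_of_tail (hσ : 0 < σ) (hξ : Measurable ξ)
    (htail : ∀ t : ℝ, 0 ≤ t →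
      μ.real {ω | t < |ξ ω|} ≤ 2 * Real.exp (-(t ^ 2 / (2 * σ ^ 2))))
    (hmean : ∫ ω, ξ ω ∂μ = 0) (t : ℝ) :
    ∫⁻ ω, ENNReal.ofReal (Real.exp (t * ξ ω)) ∂μ ≤
      ENNReal.ofReal (Real.exp (8 * σ ^ 2 * t ^ 2)) := by
  obtain ⟨h1, h2⟩ := integral_exp_mul_le_of_exp_sq hσ hξ (integrable_exp_sq_of_tail hσ hξ htail)
    (integral_exp_sq_le_of_tail hσ hξ htail) hmean t
  rw [← ofReal_integral_eq_lintegral_ofReal h1 (ae_of_all _ fun ω => (Real.exp_pos _).le)]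
  exact ENNReal.ofReal_le_ofReal h2

/-- The Laplace transform of the square of a sub-Gaussian variable whose variance is at least
`κ σ²`. -/
theorem lintegral_exp_neg_sq_le_of_tail {κ : ℝ} (hσ : 0 < σ) (hξ : Measurable ξ)
    (htail : ∀ t : ℝ, 0 ≤ t →
      μ.real {ω | t < |ξ ω|} ≤ 2 * Real.exp (-(t ^ 2 / (2 * σ ^ 2))))
    (hmean : ∫ ω, ξ ω ∂μ = 0) (hvar : κ * σ ^ 2 ≤ variance ξ μ) {l : ℝ} (hl : 0 ≤ l) :
    ∫⁻ ω, ENNReal.ofReal (Real.exp (-(l * (ξ ω ^ 2 / σ ^ 2)))) ∂μ ≤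
      ENNReal.ofReal (Real.exp (-(l * κ) + 48 * l ^ 2)) := by
  have hint := integrable_exp_sq_of_tail hσ hξ htail
  have hle := integral_exp_sq_le_of_tail hσ hξ htail
  rw [variance_of_integral_eq_zero hξ.aemeasurable hmean] at hvar
  set Z : Ω → ℝ := fun ω => ξ ω ^ 2 / (4 * σ ^ 2) with hZ
  have hZm : Measurable Z := by fun_prop
  have hZ0 : ∀ ω, 0 ≤ Z ω := fun ω => by positivity
  have hZint : Integrable Z μ := by
    refine hint.mono' (by fun_prop) (ae_of_all _ fun ω => ?_)
    rw [Real.norm_eq_abs, abs_of_nonneg (hZ0 ω)]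
    linarith [Real.add_one_le_exp (Z ω)]
  have hvar' : κ / 4 ≤ ∫ ω, Z ω ∂μ := by
    rw [hZ, integral_div, le_div_iff₀ (by positivity)]
    have : ∫ ω, ξ ω ^ 2 ∂μ = ∫ ω, (ξ ^ 2) ω ∂μ := rfl
    linarith
  -- Second-order expansion with `Z² ≤ 2 exp Z`. The mean of `Z` yields the gain `lκ`, and the
  -- moment bound 3 the loss 16 · 3 = 48.
  have hpt : ∀ ω, Real.exp (-(l * (ξ ω ^ 2 / σ ^ 2))) ≤
      1 - 4 * l * Z ω + 16 * l ^ 2 * Real.exp (Z ω) := by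
    intro ω
    have h1 : ξ ω ^ 2 / σ ^ 2 = 4 * Z ω := by
      simp only [hZ]
      field_simp
    rw [h1]
    have h2 : Real.exp (-(l * (4 * Z ω))) ≤
        1 - l * (4 * Z ω) + (l * (4 * Z ω)) ^ 2 / 2 :=
      Real.exp_neg_le_quadratic (mul_nonneg hl (mul_nonneg (by norm_num) (hZ0 ω)))
    have h3 := Real.quadratic_le_exp_of_nonneg (hZ0 ω)
    have h4 : Z ω ^ 2 ≤ 2 * Real.exp (Z ω) := by linarith [hZ0 ω]
    nlinarith [mul_le_mul_of_nonneg_left h4 (sq_nonneg l)]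
  have hI' : Integrable (fun ω => 1 - 4 * l * Z ω) μ :=
    (integrable_const _).sub (hZint.const_mul _)
  have hI : Integrable (fun ω => 1 - 4 * l * Z ω + 16 * l ^ 2 * Real.exp (Z ω)) μ :=
    hI'.add (hint.const_mul _)
  calc ∫⁻ ω, ENNReal.ofReal (Real.exp (-(l * (ξ ω ^ 2 / σ ^ 2)))) ∂μ
      ≤ ∫⁻ ω, ENNReal.ofReal (1 - 4 * l * Z ω + 16 * l ^ 2 * Real.exp (Z ω)) ∂μ :=
        lintegral_mono fun ω => ENNReal.ofReal_le_ofReal (hpt ω)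
    _ = ENNReal.ofReal (∫ ω, (1 - 4 * l * Z ω + 16 * l ^ 2 * Real.exp (Z ω)) ∂μ) :=
        (ofReal_integral_eq_lintegral_ofReal hI
          (ae_of_all _ fun ω => (Real.exp_pos _).le.trans (hpt ω))).symm
    _ ≤ ENNReal.ofReal (Real.exp (-(l * κ) + 48 * l ^ 2)) := by
        refine ENNReal.ofReal_le_ofReal ?_
        rw [integral_add hI' (hint.const_mul _),
          integral_sub (integrable_const _) (hZint.const_mul _), integral_const_mul,
          integral_const_mul]
        have h5 := Real.add_one_le_exp (-(l * κ) + 48 * l ^ 2)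
        have h6 := mul_le_mul_of_nonneg_left hvar' hl
        have h7 := mul_le_mul_of_nonneg_left hle (sq_nonneg l)
        simp only [integral_const, probReal_univ, smul_eq_mul, mul_one]
        linarith

end SubGaussian

/-! ### Gaussian integrals used for decoupling -/

section GaussianDecoupling

theorem lintegral_exp_mul_gaussianReal (t : ℝ) :
    ∫⁻ x, ENNReal.ofReal (Real.exp (t * x)) ∂gaussianReal 0 1 =
      ENNReal.ofReal (Real.exp (t ^ 2 / 2)) := by
  rw [← ofReal_integral_eq_lintegral_ofReal (integrable_exp_mul_gaussianReal t)
    (ae_of_all _ fun ω => (Real.exp_pos _).le)]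
  have h := congrFun (mgf_fun_id_gaussianReal (μ := 0) (v := 1)) t
  rw [mgf] at h
  rw [h]
  simp

theorem lintegral_exp_sq_gaussianReal_le :
    ∫⁻ x, ENNReal.ofReal (Real.exp (x ^ 2 / 4)) ∂gaussianReal 0 1 ≤ 2 := by
  have hint : Integrable (fun x : ℝ => (√(2 * Real.pi))⁻¹ * Real.exp (-(1 / 4) * x ^ 2)) :=
    (integrable_exp_neg_mul_sq (by norm_num)).const_mul _
  rw [gaussianReal_of_var_ne_zero _ one_ne_zero,
    lintegral_withDensity_eq_lintegral_mul _ (measurable_gaussianPDF _ _) (by fun_prop)]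
  calc ∫⁻ x, (gaussianPDF 0 1 * fun x => ENNReal.ofReal (Real.exp (x ^ 2 / 4))) x
      = ∫⁻ x, ENNReal.ofReal ((√(2 * Real.pi))⁻¹ * Real.exp (-(1 / 4) * x ^ 2)) := by
        refine lintegral_congr fun x => ?_
        rw [Pi.mul_apply, gaussianPDF, gaussianPDFReal, ← ENNReal.ofReal_mul (by positivity),
          mul_assoc, ← Real.exp_add]
        simp only [NNReal.coe_one, mul_one, sub_zero]
        ring_nf
    _ = ENNReal.ofReal √2 := by
        rw [← ofReal_integral_eq_lintegral_ofReal hint (ae_of_all _ fun x => by positivity),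
          integral_const_mul, integral_gaussian, ← Real.sqrt_inv, ← Real.sqrt_mul (by positivity)]
        congr 2
        field_simp
        norm_num
    _ ≤ 2 := by
        have : √2 ≤ 2 := Real.sqrt_le_iff.2 ⟨by norm_num, by norm_num⟩
        exact (ENNReal.ofReal_le_ofReal this).trans (by norm_num)

theorem lintegral_pi_prod_eq_prod {ι : Type*} [Fintype ι] (ν : Measure ℝ) [IsProbabilityMeasure ν]
    (F : ι → ℝ → ENNReal) (hF : ∀ i, Measurable (F i)) :
    ∫⁻ g : ι → ℝ, ∏ i, F i (g i) ∂Measure.pi (fun _ => ν) = ∏ i, ∫⁻ x, F i x ∂ν := by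
  rw [lintegral_prod_eq_prod_lintegral_of_indepFun Finset.univ (fun i (g : ι → ℝ) => F i (g i))
    (iIndepFun_pi fun i => (hF i).aemeasurable) fun i => (hF i).comp (measurable_pi_apply i)]
  refine Finset.prod_congr rfl fun i _ => ?_
  exact (measurePreserving_eval (fun _ : ι => ν) i).lintegral_comp (hF i)

theorem ofReal_exp_sum {ι : Type*} (s : Finset ι) (f : ι → ℝ) :
    ENNReal.ofReal (Real.exp (∑ i ∈ s, f i)) = ∏ i ∈ s, ENNReal.ofReal (Real.exp (f i)) := by
  rw [Real.exp_sum, ENNReal.ofReal_prod_of_nonneg fun i _ => (Real.exp_pos _).le]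

theorem lintegral_exp_dotProduct_gaussian {ι : Type*} [Fintype ι] (x : ι → ℝ) :
    ∫⁻ g : ι → ℝ, ENNReal.ofReal (Real.exp (g ⬝ᵥ x)) ∂Measure.pi (fun _ => gaussianReal 0 1) =
      ENNReal.ofReal (Real.exp ((x ⬝ᵥ x) / 2)) := by
  have h : x ⬝ᵥ x / 2 = ∑ i, x i ^ 2 / 2 := by
    simp [dotProduct, Finset.sum_div, sq]
  rw [h, ofReal_exp_sum]
  simp only [dotProduct, ofReal_exp_sum, mul_comm _ (x _)]
  rw [lintegral_pi_prod_eq_prod _ (fun i y => ENNReal.ofReal (Real.exp (x i * y)))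
    fun i => by fun_prop]
  exact Finset.prod_congr rfl fun i _ => lintegral_exp_mul_gaussianReal _

theorem lintegral_exp_sq_gaussian_le (ι : Type*) [Fintype ι] :
    ∫⁻ g : ι → ℝ, ENNReal.ofReal (Real.exp ((g ⬝ᵥ g) / 4))
      ∂Measure.pi (fun _ => gaussianReal 0 1) ≤ 2 ^ Fintype.card ι := by
  have h : ∀ g : ι → ℝ, g ⬝ᵥ g / 4 = ∑ i, g i ^ 2 / 4 := by
    simp [dotProduct, Finset.sum_div, sq]
  simp only [h, ofReal_exp_sum]
  rw [lintegral_pi_prod_eq_prod _ (fun i y => ENNReal.ofReal (Real.exp (y ^ 2 / 4)))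
    fun i => by fun_prop]
  exact (Finset.prod_le_prod' fun i _ => lintegral_exp_sq_gaussianReal_le).trans (by simp)

end GaussianDecoupling

/-! ### Concentration of the noise vector and its projections -/

section Concentration

variable {Ω : Type*} [MeasurableSpace Ω] {μ : Measure Ω}

theorem measureReal_le_of_lintegral_exp_le {Y : Ω → ℝ} (hY : Measurable Y) {C : ℝ} (hC : 0 ≤ C)
    (h : ∫⁻ ω, ENNReal.ofReal (Real.exp (Y ω)) ∂μ ≤ ENNReal.ofReal C) (a : ℝ) :
    μ.real {ω | a ≤ Y ω} ≤ C * Real.exp (-a) := by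
  have h1 := mul_meas_ge_le_lintegral (μ := μ)
    (f := fun ω => ENNReal.ofReal (Real.exp (Y ω))) (by fun_prop) (ENNReal.ofReal (Real.exp a))
  have hset : {ω | ENNReal.ofReal (Real.exp a) ≤ ENNReal.ofReal (Real.exp (Y ω))} =
      {ω | a ≤ Y ω} := by
    ext ω
    simp only [Set.mem_ofPred_eq]
    rw [ENNReal.ofReal_le_ofReal_iff (Real.exp_pos _).le, Real.exp_le_exp]
  rw [hset] at h1
  have h2 := ENNReal.toReal_mono ENNReal.ofReal_ne_top (h1.trans h)
  rw [ENNReal.toReal_mul, ENNReal.toReal_ofReal (Real.exp_pos _).le, ENNReal.toReal_ofReal hC] at h2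
  rw [Real.exp_neg, ← div_eq_mul_inv, le_div_iff₀ (Real.exp_pos a), mul_comm]
  exact h2

variable {n : ℕ} {ξ : Fin n → Ω → ℝ} {σ : ℝ}

theorem lintegral_exp_sum_le (hmeas : ∀ i, Measurable (ξ i)) (hind : iIndepFun ξ μ)
    {F : Fin n → ℝ → ℝ} (hF : ∀ i, Measurable (F i)) {c : Fin n → ℝ}
    (h : ∀ i, ∫⁻ ω, ENNReal.ofReal (Real.exp (F i (ξ i ω))) ∂μ ≤
      ENNReal.ofReal (Real.exp (c i))) :
    ∫⁻ ω, ENNReal.ofReal (Real.exp (∑ i, F i (ξ i ω))) ∂μ ≤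
      ENNReal.ofReal (Real.exp (∑ i, c i)) := by
  simp only [ofReal_exp_sum]
  have hm : ∀ i, Measurable fun x : ℝ => ENNReal.ofReal (Real.exp (F i x)) := fun i => by
    have := hF i
    fun_prop
  rw [lintegral_prod_eq_prod_lintegral_of_indepFun Finset.univ
    (fun i ω => ENNReal.ofReal (Real.exp (F i (ξ i ω)))) (hind.comp _ hm)
    fun i => (hm i).comp (hmeas i)]
  exact Finset.prod_le_prod' fun i _ => h i

variable [IsProbabilityMeasure μ]

/-- Exponential moment of the squared norm of the projection of a sub-Gaussian noise vector,
obtained by integrating its Laplace transform against a Gaussian vector. -/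
theorem lintegral_exp_projection_le (hσ : 0 < σ) (hmeas : ∀ i, Measurable (ξ i))
    (hind : iIndepFun ξ μ) (hmean : ∀ i, ∫ ω, ξ i ω ∂μ = 0)
    (htail : ∀ i, ∀ t : ℝ, 0 ≤ t →
      μ.real {ω | t < |ξ i ω|} ≤ 2 * Real.exp (-(t ^ 2 / (2 * σ ^ 2))))
    {d : ℕ} (Q : Matrix (Fin d) (Fin n) ℝ) (hQ : Q * Qᵀ = 1) :
    ∫⁻ ω, ENNReal.ofReal (Real.exp (l2norm (Q *ᵥ fun i => ξ i ω) ^ 2 / (128 * σ ^ 2))) ∂μ ≤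
      2 ^ d := by
  set γ : Measure (Fin d → ℝ) := Measure.pi (fun _ => gaussianReal 0 1) with hγ
  -- The quadratic exponent becomes the Gaussian average of a linear one, to which independence of
  -- the errors applies; 128 = 2 · 8².
  have hrep : ∀ ω, ENNReal.ofReal
      (Real.exp (l2norm (Q *ᵥ fun i => ξ i ω) ^ 2 / (128 * σ ^ 2))) =
      ∫⁻ g, ENNReal.ofReal (Real.exp (g ⬝ᵥ ((8 * σ)⁻¹ • (Q *ᵥ fun i => ξ i ω)))) ∂γ := by
    intro ω
    rw [hγ, lintegral_exp_dotProduct_gaussian, l2norm_sq, smul_dotProduct, dotProduct_smul,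
      smul_eq_mul, smul_eq_mul]
    congr 2
    field_simp
    ring
  simp only [hrep]
  have hjoint : Measurable fun z : Ω × (Fin d → ℝ) =>
      ENNReal.ofReal (Real.exp (z.2 ⬝ᵥ ((8 * σ)⁻¹ • (Q *ᵥ fun i => ξ i z.1)))) := by
    refine (Real.measurable_exp.comp ?_).ennreal_ofReal
    simp only [dotProduct, Matrix.mulVec, Pi.smul_apply]
    fun_prop
  rw [lintegral_lintegral_swap hjoint.aemeasurable]
  have hγ2 := lintegral_exp_sq_gaussian_le (Fin d)
  rw [Fintype.card_fin] at hγ2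
  refine (lintegral_mono fun g => ?_).trans hγ2
  set u := g ᵥ* Q with hu
  -- Orthonormal rows preserve the norm of `g`, so the noise integral is at most `exp (‖g‖² / 8)`,
  -- with room to spare.
  have hnorm : u ⬝ᵥ u = g ⬝ᵥ g := by
    rw [hu, ← Matrix.dotProduct_mulVec, ← Matrix.mulVec_transpose Q g, Matrix.mulVec_mulVec, hQ,
      Matrix.one_mulVec]
  have hlin : ∀ ω, g ⬝ᵥ ((8 * σ)⁻¹ • (Q *ᵥ fun i => ξ i ω)) =
      ∑ i, ((8 * σ)⁻¹ * u i) * ξ i ω := by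
    intro ω
    rw [dotProduct_smul, Matrix.dotProduct_mulVec, ← hu, smul_eq_mul, dotProduct, Finset.mul_sum]
    exact Finset.sum_congr rfl fun i _ => by ring
  simp only [hlin]
  refine (lintegral_exp_sum_le hmeas hind (F := fun i x => ((8 * σ)⁻¹ * u i) * x)
    (fun i => by fun_prop) fun i => lintegral_exp_mul_le_of_tail hσ (hmeas i) (htail i)
      (hmean i) _).trans (ENNReal.ofReal_le_ofReal (Real.exp_le_exp.2 ?_))
  have h1 : ∀ i, 8 * σ ^ 2 * ((8 * σ)⁻¹ * u i) ^ 2 = (u i * u i) / 8 := by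
    intro i
    field_simp
  simp only [h1]
  rw [← Finset.sum_div, ← hnorm]
  have h2 : 0 ≤ u ⬝ᵥ u := by rw [← l2norm_sq]; positivity
  rw [dotProduct] at h2 ⊢
  linarith

/-- Markov's inequality at level `exp (3n)`, with exponential moment at most `3 ^ n ≤ exp (2n)`. -/
theorem measureReal_noise_norm_ge_le (hσ : 0 < σ) (hmeas : ∀ i, Measurable (ξ i))
    (hind : iIndepFun ξ μ)
    (htail : ∀ i, ∀ t : ℝ, 0 ≤ t →
      μ.real {ω | t < |ξ i ω|} ≤ 2 * Real.exp (-(t ^ 2 / (2 * σ ^ 2)))) :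
    μ.real {ω | 12 * n * σ ^ 2 ≤ l2norm (fun i => ξ i ω) ^ 2} ≤ Real.exp (-n) := by
  have h3 : (3 : ℝ) ≤ Real.exp 2 := by
    have := Real.add_one_le_exp (2 : ℝ)
    linarith
  have h1 := lintegral_exp_sum_le hmeas hind (F := fun _ x => x ^ 2 / (4 * σ ^ 2))
    (c := fun _ => 2) (fun i => by fun_prop) fun i =>
      (lintegral_exp_sq_le_of_tail hσ (hmeas i) (htail i)).trans (by
        rw [← ENNReal.ofReal_ofNat]
        exact ENNReal.ofReal_le_ofReal h3)
  have h2 := measureReal_le_of_lintegral_exp_le (by fun_prop) (Real.exp_pos _).le h1 (3 * n)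
  rw [← Real.exp_add] at h2
  convert h2 using 2
  · congr 1
    ext ω
    rw [← Finset.sum_div, le_div_iff₀ (by positivity), l2norm_sq, dotProduct]
    simp only [sq]
    ring_nf
  · simp only [Finset.sum_const, Finset.card_univ, Fintype.card_fin, nsmul_eq_mul]
    ring

theorem measureReal_noise_norm_le_le {κ : ℝ} (hκ : 0 < κ) (hσ : 0 < σ)
    (hmeas : ∀ i, Measurable (ξ i)) (hind : iIndepFun ξ μ) (hmean : ∀ i, ∫ ω, ξ i ω ∂μ = 0)
    (htail : ∀ i, ∀ t : ℝ, 0 ≤ t →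
      μ.real {ω | t < |ξ i ω|} ≤ 2 * Real.exp (-(t ^ 2 / (2 * σ ^ 2))))
    (hvar : ∀ i, κ * σ ^ 2 ≤ variance (ξ i) μ) :
    μ.real {ω | l2norm (fun i => ξ i ω) ^ 2 ≤ κ / 2 * n * σ ^ 2} ≤
      Real.exp (-(κ ^ 2 / 768 * n)) := by
  -- The choice `l = κ / 192` minimizes the exponent per observation `-lκ/2 + 48 l²`, with value
  -- `-κ² / 768`.
  have h1 := lintegral_exp_sum_le hmeas hind (F := fun _ x => -(κ / 192 * (x ^ 2 / σ ^ 2)))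
    (c := fun _ => -(κ / 192 * κ) + 48 * (κ / 192) ^ 2) (fun i => by fun_prop) fun i =>
      lintegral_exp_neg_sq_le_of_tail hσ (hmeas i) (htail i) (hmean i) (hvar i) (by positivity)
  have h2 := measureReal_le_of_lintegral_exp_le (by fun_prop) (Real.exp_pos _).le h1
    (-(κ / 192 * (κ / 2 * n)))
  rw [← Real.exp_add] at h2
  convert h2 using 2
  · congr 1
    ext ω
    rw [Finset.sum_neg_distrib, neg_le_neg_iff, ← Finset.mul_sum, ← Finset.sum_div,
      mul_le_mul_iff_right₀ (by positivity), div_le_iff₀ (by positivity), l2norm_sq, dotProduct]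
    simp only [sq]
  · simp only [Finset.sum_const, Finset.card_univ, Fintype.card_fin, nsmul_eq_mul]
    ring

end Concentration

/-! ### Orthonormal bases of column spans -/

section ColumnSpace

variable {n p : ℕ}

/-- An orthonormal basis, as the rows of `Q`, of the span of the columns of `X` indexed by `T`. -/
theorem exists_orthonormal_rows (X : Matrix (Fin n) (Fin p) ℝ) (T : Finset (Fin p)) :
    ∃ d ≤ T.card, ∃ Q : Matrix (Fin d) (Fin n) ℝ, Q * Qᵀ = 1 ∧
      ∀ v, vecSupport v ⊆ T → Qᵀ *ᵥ (Q *ᵥ (X *ᵥ v)) = X *ᵥ v := by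
  classical
  set c : Fin p → EuclideanSpace ℝ (Fin n) := fun j => WithLp.toLp 2 (X.col j) with hc
  set W : Submodule ℝ (EuclideanSpace ℝ (Fin n)) :=
    Submodule.span ℝ ((T.image c : Finset _) : Set (EuclideanSpace ℝ (Fin n))) with hW
  set B := stdOrthonormalBasis ℝ W with hB
  -- The columns may be dependent, so `d` is their rank.
  refine ⟨Module.finrank ℝ W, (finrank_span_finset_le_card _).trans Finset.card_image_le,
    Matrix.of fun j i => (B j : EuclideanSpace ℝ (Fin n)) i, ?_, fun v hv => ?_⟩
  · ext j k
    have h := orthonormal_iff_ite.1 B.orthonormal k j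
    rw [Submodule.coe_inner, PiLp.inner_apply] at h
    simp only [RCLike.inner_apply, conj_trivial] at h
    rw [Matrix.mul_apply, Matrix.one_apply]
    simp only [Matrix.of_apply, Matrix.transpose_apply]
    rw [h]
    simp [eq_comm]
  · have hmem : (WithLp.toLp 2 (X *ᵥ v) : EuclideanSpace ℝ (Fin n)) ∈ W := by
      have : (WithLp.toLp 2 (X *ᵥ v) : EuclideanSpace ℝ (Fin n)) = ∑ j, v j • c j := by
        ext i
        simp [hc, Matrix.mulVec, dotProduct, mul_comm]
      rw [this]
      refine Submodule.sum_mem _ fun j _ => ?_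
      by_cases hj : j ∈ T
      · exact Submodule.smul_mem _ _ (Submodule.subset_span (by simpa using ⟨j, hj, rfl⟩))
      · rw [vecSupport_subset_iff.1 hv j hj, zero_smul]
        exact Submodule.zero_mem _
    have h := congrArg (fun w : W => (w : EuclideanSpace ℝ (Fin n)))
      (B.sum_repr' ⟨_, hmem⟩)
    simp only [Submodule.coe_sum, Submodule.coe_smul] at h
    ext i
    have hi := congrArg (fun w : EuclideanSpace ℝ (Fin n) => w i) h
    simp only [WithLp.ofLp_sum, WithLp.ofLp_smul, Finset.sum_apply, Pi.smul_apply,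
      smul_eq_mul] at hi
    rw [← hi]
    simp only [Submodule.coe_inner, PiLp.inner_apply, RCLike.inner_apply, conj_trivial,
      Matrix.mulVec, dotProduct, Matrix.transpose_apply, Matrix.of_apply]
    refine Finset.sum_congr rfl fun j _ => ?_
    rw [mul_comm]
    congr 1
    exact Finset.sum_congr rfl fun k _ => mul_comm _ _

theorem abs_dotProduct_le_of_orthonormal_rows {d : ℕ} {Q : Matrix (Fin d) (Fin n) ℝ}
    {e w : Fin n → ℝ} (hw : Qᵀ *ᵥ (Q *ᵥ w) = w) :
    |e ⬝ᵥ w| ≤ l2norm (Q *ᵥ e) * l2norm w := by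
  have h : ∀ u, u ⬝ᵥ w = (Q *ᵥ u) ⬝ᵥ (Q *ᵥ w) := by
    intro u
    nth_rw 1 [← hw]
    rw [Matrix.dotProduct_mulVec, Matrix.vecMul_transpose]
  have hn : l2norm w = l2norm (Q *ᵥ w) := by
    rw [← sq_eq_sq₀ (l2norm_nonneg _) (l2norm_nonneg _), l2norm_sq, l2norm_sq, h]
  rw [h, hn]
  exact abs_dotProduct_le _ _

end ColumnSpace

/-! ### Growth of the complexity s log(p/s) -/

section Complexity

/-- The complexity `s log (p / s)` of the models of size `s` among `p` variables. -/
noncomputable def modelComplexity (p s : ℕ) : ℝ := s * Real.log ((p : ℝ) / s)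

theorem Real.one_lt_log_three : 1 < Real.log 3 := by
  rw [Real.lt_log_iff_exp_lt (by norm_num)]
  exact Real.exp_one_lt_d9.trans (by norm_num)

variable {p r s : ℕ}

theorem log_three_le_log_div (hs : 1 ≤ s) (hp : 3 * s ≤ p) :
    Real.log 3 ≤ Real.log ((p : ℝ) / s) := by
  have hs' : (0 : ℝ) < s := by exact_mod_cast hs
  refine Real.log_le_log (by norm_num) ?_
  rw [le_div_iff₀ hs']
  exact_mod_cast hp

theorem le_modelComplexity (hs : 1 ≤ s) (hp : 3 * s ≤ p) : (s : ℝ) ≤ modelComplexity p s := by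
  have h := log_three_le_log_div hs hp
  have := Real.one_lt_log_three
  rw [modelComplexity]
  nlinarith [(Nat.cast_nonneg s : (0 : ℝ) ≤ s)]

/-- For x ≤ p/3 the slope of x log(p/x) is log(p/x) - 1 ≥ log 3 - 1 > 0. The linear gap makes the
union bound over sizes geometric. -/
theorem modelComplexity_add_le (hr : 1 ≤ r) (hrs : r ≤ s) (hp : 3 * s ≤ p) :
    modelComplexity p r + (Real.log 3 - 1) * (s - r) ≤ modelComplexity p s := by
  have hr' : (0 : ℝ) < r := by exact_mod_cast hr
  have hrs' : (r : ℝ) ≤ s := by exact_mod_cast hrs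
  have hs' : (0 : ℝ) < s := hr'.trans_le hrs'
  have hp' : (0 : ℝ) < p := by
    have : 0 < p := by omega
    exact_mod_cast this
  have h := log_three_le_log_div (hr.trans hrs) hp
  have h1 : Real.log ((p : ℝ) / r) = Real.log ((p : ℝ) / s) + Real.log ((s : ℝ) / r) := by
    rw [← Real.log_mul (by positivity) (by positivity)]
    congr 1
    field_simp
  have h2 : r * Real.log ((s : ℝ) / r) ≤ s - r := by
    have h3 := Real.log_le_sub_one_of_pos (show (0 : ℝ) < (s : ℝ) / r by positivity)
    calc r * Real.log ((s : ℝ) / r) ≤ r * ((s : ℝ) / r - 1) :=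
          mul_le_mul_of_nonneg_left h3 hr'.le
      _ = s - r := by field_simp
  rw [modelComplexity, modelComplexity, h1]
  nlinarith [mul_le_mul_of_nonneg_left h (sub_nonneg.2 hrs')]

theorem modelComplexity_mono (hr : 1 ≤ r) (hrs : r ≤ s) (hp : 3 * s ≤ p) :
    modelComplexity p r ≤ modelComplexity p s := by
  have h := modelComplexity_add_le hr hrs hp
  have hrs' : (r : ℝ) ≤ s := by exact_mod_cast hrs
  nlinarith [Real.one_lt_log_three]

/-- The extreme case r = s/2, log(p/s) = 1 gives the ratio (1 + log 2)/2 < 0.85. The slack 0.1 is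
the penalty gap that defeats overfitting. -/
theorem modelComplexity_le_of_two_mul_le (hr : 1 ≤ r) (hrs : 2 * r ≤ s) (hp : 3 * s ≤ p) :
    modelComplexity p r ≤ 0.9 * modelComplexity p s := by
  have hr' : (0 : ℝ) < r := by exact_mod_cast hr
  have hrs' : 2 * (r : ℝ) ≤ s := by exact_mod_cast hrs
  have hs' : (0 : ℝ) < s := by linarith
  have hp' : (0 : ℝ) < p := by
    have : 0 < p := by omega
    exact_mod_cast this
  have h := log_three_le_log_div (by omega) hp
  have hL : 1 ≤ Real.log ((p : ℝ) / s) := by linarith [Real.one_lt_log_three]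
  have h1 : Real.log ((p : ℝ) / r) =
      Real.log ((p : ℝ) / s) + (Real.log 2 + Real.log ((s : ℝ) / (2 * r))) := by
    rw [← Real.log_mul (by positivity) (by positivity),
      ← Real.log_mul (by positivity) (by positivity)]
    congr 1
    field_simp
  have h2 : r * Real.log ((s : ℝ) / (2 * r)) ≤ s / 2 - r := by
    have h3 := Real.log_le_sub_one_of_pos (show (0 : ℝ) < (s : ℝ) / (2 * r) by positivity)
    calc r * Real.log ((s : ℝ) / (2 * r)) ≤ r * ((s : ℝ) / (2 * r) - 1) :=
          mul_le_mul_of_nonneg_left h3 hr'.le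
      _ = s / 2 - r := by field_simp
  have h4 : r * Real.log 2 ≤ r * 0.6931471808 :=
    mul_le_mul_of_nonneg_left Real.log_two_lt_d9.le hr'.le
  have h5 : 0.9 * (s : ℝ) - r ≤ (0.9 * s - r) * Real.log ((p : ℝ) / s) :=
    le_mul_of_one_le_right (by linarith) hL
  rw [modelComplexity, modelComplexity, h1]
  linarith

/-- For k = 3s, C(p, k) ≤ (ep/k)^k; replacing e by 3 cancels the 3 in k. -/
theorem choose_le_exp_modelComplexity (hs : 1 ≤ s) (hp : 3 * s ≤ p) :
    (p.choose (3 * s) : ℝ) ≤ Real.exp (3 * modelComplexity p s) := by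
  have hs' : (0 : ℝ) < s := by exact_mod_cast hs
  have hp' : (0 : ℝ) < p := by
    have : 0 < p := by omega
    exact_mod_cast this
  set k := 3 * s with hk
  have hk' : (k : ℝ) = 3 * s := by rw [hk]; push_cast; ring
  have hk0 : (0 : ℝ) < k := by rw [hk']; positivity
  have hf : (0 : ℝ) < (Nat.factorial k : ℝ) := by exact_mod_cast Nat.factorial_pos k
  have h1 : (p.choose k : ℝ) ≤ (p : ℝ) ^ k / (Nat.factorial k : ℝ) := Nat.choose_le_pow_div k p
  have h2 := Real.pow_div_factorial_le_exp (k : ℝ) hk0.le k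
  have h3 : Real.exp k ≤ 3 ^ k := by
    rw [← Real.exp_one_pow]
    exact pow_le_pow_left₀ (Real.exp_pos _).le (Real.exp_one_lt_d9.trans (by norm_num)).le _
  have h4 : (p : ℝ) ^ k / (Nat.factorial k : ℝ) =
      ((p : ℝ) / k) ^ k * ((k : ℝ) ^ k / (Nat.factorial k : ℝ)) := by
    rw [div_pow]
    field_simp
  have h5 : Real.exp (3 * modelComplexity p s) = ((p : ℝ) / k) ^ k * 3 ^ k := by
    rw [← mul_pow, hk', show (p : ℝ) / (3 * s) * 3 = p / s by field_simp, modelComplexity,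
      ← mul_assoc, ← hk', Real.exp_nat_mul, Real.exp_log (by positivity)]
  rw [h5]
  refine h1.trans (h4.le.trans ?_)
  exact mul_le_mul_of_nonneg_left (h2.trans h3) (by positivity)

end Complexity

/-! ### Uniform control of the noise on sparse subspaces -/

section NoiseEvent

variable {Ω : Type*} [MeasurableSpace Ω] {μ : Measure Ω} [IsProbabilityMeasure μ]
  {n p s r m : ℕ} {ξ : Fin n → Ω → ℝ} {σ : ℝ}

/-- Level `8f` beats both the moment `2 ^ (3s) ≤ exp (3f)` and the number of supports, at most `exp
(3f)`; and 8 · 128 = 32². -/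
theorem exists_noise_event (X : Matrix (Fin n) (Fin p) ℝ) (hσ : 0 < σ)
    (hmeas : ∀ i, Measurable (ξ i)) (hind : iIndepFun ξ μ) (hmean : ∀ i, ∫ ω, ξ i ω ∂μ = 0)
    (htail : ∀ i, ∀ t : ℝ, 0 ≤ t →
      μ.real {ω | t < |ξ i ω|} ≤ 2 * Real.exp (-(t ^ 2 / (2 * σ ^ 2))))
    (hs : 1 ≤ s) (hp : 3 * s ≤ p) :
    ∃ N : Set Ω, MeasurableSet N ∧ μ.real N ≤ Real.exp (-modelComplexity p s) ∧
      ∀ ω ∉ N, ∀ v : Fin p → ℝ, (vecSupport v).card ≤ 3 * s →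
        |(fun i => ξ i ω) ⬝ᵥ (X *ᵥ v)| ≤
          (32 * σ * √(modelComplexity p s)) * l2norm (X *ᵥ v) := by
  choose d hd Q hQ hQX using exists_orthonormal_rows X
  set f := modelComplexity p s with hf
  have hfs : (s : ℝ) ≤ f := le_modelComplexity hs hp
  have hf0 : 0 ≤ f := (Nat.cast_nonneg s).trans hfs
  set Y : Finset (Fin p) → Ω → ℝ :=
    fun T ω => l2norm (Q T *ᵥ fun i => ξ i ω) ^ 2 / (128 * σ ^ 2) with hY
  have hYm : ∀ T, Measurable (Y T) := by
    intro T
    simp only [hY, l2norm_sq, dotProduct, Matrix.mulVec]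
    fun_prop
  have hprob : ∀ T ∈ Finset.powersetCard (3 * s) (Finset.univ : Finset (Fin p)),
      μ.real {ω | 8 * f ≤ Y T ω} ≤ Real.exp (-(5 * f)) := by
    intro T hT
    have hcard := (Finset.mem_powersetCard.1 hT).2
    have h1 := measureReal_le_of_lintegral_exp_le (μ := μ) (hYm T)
      (C := Real.exp (3 * s)) (Real.exp_pos _).le
      ((lintegral_exp_projection_le hσ hmeas hind hmean htail (Q T) (hQ T)).trans ?_) (8 * f)
    · refine h1.trans ?_
      rw [← Real.exp_add, Real.exp_le_exp]
      linarith
    · have h2 : ((2 : ENNReal)) ^ d T = ENNReal.ofReal (2 ^ d T) := by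
        rw [ENNReal.ofReal_pow (by norm_num), ENNReal.ofReal_ofNat]
      rw [h2]
      refine ENNReal.ofReal_le_ofReal ?_
      calc (2 : ℝ) ^ d T ≤ 2 ^ (3 * s) :=
            pow_le_pow_right₀ (by norm_num) ((hd T).trans hcard.le)
        _ ≤ (Real.exp 1) ^ (3 * s) :=
            pow_le_pow_left₀ (by norm_num) (by linarith [Real.add_one_le_exp (1 : ℝ)]) _
        _ = Real.exp (3 * s) := by
            rw [Real.exp_one_pow]
            push_cast
            ring_nf
  refine ⟨⋃ T ∈ Finset.powersetCard (3 * s) (Finset.univ : Finset (Fin p)), {ω | 8 * f ≤ Y T ω},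
    Finset.measurableSet_biUnion _ fun T _ => measurableSet_le measurable_const (hYm T), ?_, ?_⟩
  · refine (measureReal_biUnion_finset_le _ _).trans ((Finset.sum_le_sum hprob).trans ?_)
    rw [Finset.sum_const, Finset.card_powersetCard, Finset.card_univ, Fintype.card_fin,
      nsmul_eq_mul]
    calc (p.choose (3 * s) : ℝ) * Real.exp (-(5 * f))
        ≤ Real.exp (3 * f) * Real.exp (-(5 * f)) :=
          mul_le_mul_of_nonneg_right (choose_le_exp_modelComplexity hs hp) (Real.exp_pos _).le
      _ ≤ Real.exp (-f) := by
          rw [← Real.exp_add, Real.exp_le_exp]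
          linarith
  · intro ω hω v hv
    obtain ⟨T, hvT, -, hT⟩ := Finset.exists_subsuperset_card_eq (Finset.subset_univ (vecSupport v))
      hv (by simpa using hp)
    have hω' : Y T ω < 8 * f := by
      by_contra h
      refine hω (Set.mem_biUnion (x := T) ?_ (not_lt.1 h))
      simpa using hT
    refine (abs_dotProduct_le_of_orthonormal_rows (hQX T v hvT)).trans
      (mul_le_mul_of_nonneg_right ?_ (l2norm_nonneg _))
    refine (abs_le_of_sq_le_sq' ?_ (by positivity)).2
    simp only [hY] at hω'
    rw [div_lt_iff₀ (by positivity)] at hω'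
    rw [mul_pow, mul_pow, Real.sq_sqrt hf0]
    linarith

/-- The noise event, uniformly over all model sizes between `r` and `m`. -/
theorem exists_uniform_noise_event (X : Matrix (Fin n) (Fin p) ℝ) (hσ : 0 < σ)
    (hmeas : ∀ i, Measurable (ξ i)) (hind : iIndepFun ξ μ) (hmean : ∀ i, ∫ ω, ξ i ω ∂μ = 0)
    (htail : ∀ i, ∀ t : ℝ, 0 ≤ t →
      μ.real {ω | t < |ξ i ω|} ≤ 2 * Real.exp (-(t ^ 2 / (2 * σ ^ 2))))
    (hr : 1 ≤ r) (hp : 3 * m ≤ p) :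
    ∃ N : Set Ω, MeasurableSet N ∧
      μ.real N ≤ (1 - Real.exp (1 - Real.log 3))⁻¹ * Real.exp (-modelComplexity p r) ∧
      ∀ ω ∉ N, ∀ s, r ≤ s → s ≤ m → ∀ v : Fin p → ℝ, (vecSupport v).card ≤ 3 * s →
        |(fun i => ξ i ω) ⬝ᵥ (X *ᵥ v)| ≤
          (32 * σ * √(modelComplexity p s)) * l2norm (X *ᵥ v) := by
  have hex : ∀ s : ℕ, ∃ N : Set Ω, MeasurableSet N ∧ (r ≤ s → s ≤ m →
      μ.real N ≤ Real.exp (-modelComplexity p s) ∧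
      ∀ ω ∉ N, ∀ v : Fin p → ℝ, (vecSupport v).card ≤ 3 * s →
        |(fun i => ξ i ω) ⬝ᵥ (X *ᵥ v)| ≤
          (32 * σ * √(modelComplexity p s)) * l2norm (X *ᵥ v)) := by
    intro s
    by_cases h : r ≤ s ∧ s ≤ m
    · obtain ⟨N, h1, h2⟩ := exists_noise_event X hσ hmeas hind hmean htail (hr.trans h.1)
        (by omega : 3 * s ≤ p)
      exact ⟨N, h1, fun _ _ => h2⟩
    · exact ⟨∅, MeasurableSet.empty, fun h1 h2 => absurd ⟨h1, h2⟩ h⟩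
  choose N hNm hN using hex
  refine ⟨⋃ s ∈ Finset.Icc r m, N s, Finset.measurableSet_biUnion _ fun s _ => hNm s, ?_, ?_⟩
  · refine (measureReal_biUnion_finset_le _ _).trans ?_
    -- The ratio is e/3 < 1.
    set q := Real.exp (1 - Real.log 3) with hq
    have hq1 : q < 1 := Real.exp_lt_one_iff.2 (by linarith [Real.one_lt_log_three])
    have hq0 : 0 ≤ q := (Real.exp_pos _).le
    have hterm : ∀ s ∈ Finset.Icc r m,
        μ.real (N s) ≤ Real.exp (-modelComplexity p r) * q ^ (s - r) := by
      intro s hs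
      rw [Finset.mem_Icc] at hs
      refine (hN s hs.1 hs.2).1.trans ?_
      rw [hq, ← Real.exp_nat_mul, ← Real.exp_add, Real.exp_le_exp, Nat.cast_sub hs.1]
      have := modelComplexity_add_le hr hs.1 (by omega : 3 * s ≤ p)
      linarith
    refine (Finset.sum_le_sum hterm).trans ?_
    rw [← Finset.mul_sum, mul_comm]
    refine mul_le_mul_of_nonneg_right ?_ (Real.exp_pos _).le
    calc ∑ s ∈ Finset.Icc r m, q ^ (s - r) = ∑ j ∈ Finset.range (m + 1 - r), q ^ j := by
          rw [← Finset.Ico_add_one_right_eq_Icc, Finset.sum_Ico_eq_sum_range]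
          simp
      _ ≤ ∑' j, q ^ j := (summable_geometric_of_lt_one hq0 hq1).sum_le_tsum _
          fun j _ => pow_nonneg hq0 j
      _ = (1 - q)⁻¹ := tsum_geometric_of_lt_one hq0 hq1
  · intro ω hω s hs1 hs2
    refine (hN s hs1 hs2).2 ω fun h => hω ?_
    exact Set.mem_biUnion (x := s) (by simpa using ⟨hs1, hs2⟩) h

end NoiseEvent

/-! ### Residual bounds and the information criterion -/

section Selection

variable {n p : ℕ} {X : Matrix (Fin n) (Fin p) ℝ}

theorem sq_residual_le_of_infoCrit_le {y : Fin n → ℝ} {K : ℝ} {s r : ℕ} {b c : Fin p → ℝ}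
    (hn : 0 < n) (h : infoCrit X y K s b ≤ infoCrit X y K r c) :
    l2norm (y - X *ᵥ b) ^ 2 ≤ l2norm (y - X *ᵥ c) ^ 2 *
      Real.exp (K / n * (modelComplexity p r - modelComplexity p s)) := by
  have hn' : (0 : ℝ) < n := by exact_mod_cast hn
  have hb0 : 0 ≤ empLoss X y b := by unfold empLoss; positivity
  have hc0 : 0 ≤ empLoss X y c := by unfold empLoss; positivity
  have key : empLoss X y b ≤ empLoss X y c *
      Real.exp (K / n * (modelComplexity p r - modelComplexity p s)) := by
    rcases hb0.eq_or_lt with hb | hb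
    · rw [← hb]
      positivity
    -- A vanishing loss of `c` makes its criterion `-∞`, which a positive loss of `b` cannot match.
    rcases hc0.eq_or_lt with hc | hc
    · rw [infoCrit, infoCrit, ← hc, ENNReal.log_ofReal_of_pos hb, ENNReal.ofReal_zero,
        ENNReal.log_zero, EReal.bot_add, ← EReal.coe_add, le_bot_iff] at h
      exact absurd h (EReal.coe_ne_bot _)
    · rw [infoCrit, infoCrit, ENNReal.log_ofReal_of_pos hb, ENNReal.log_ofReal_of_pos hc,
        ← EReal.coe_add, ← EReal.coe_add, EReal.coe_le_coe_iff] at h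
      rw [← Real.log_le_log_iff hb (by positivity), Real.log_mul hc.ne' (Real.exp_ne_zero _),
        Real.log_exp, modelComplexity, modelComplexity]
      have e1 : K / n * (r * Real.log ((p : ℝ) / r) - s * Real.log ((p : ℝ) / s)) =
          K * ((r : ℝ) / n) * Real.log ((p : ℝ) / r) -
            K * ((s : ℝ) / n) * Real.log ((p : ℝ) / s) := by ring
      rw [e1]
      linarith
  rw [empLoss, empLoss, div_mul_eq_mul_div, div_le_div_iff_of_pos_right (by positivity)] at key
  exact key

variable {βstar : Fin p → ℝ} {e : Fin n → ℝ} {r : ℕ} {δ R : ℝ}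

theorem sq_residual_eq (b : Fin p → ℝ) :
    l2norm (X *ᵥ βstar + e - X *ᵥ b) ^ 2 =
      l2norm e ^ 2 - 2 * (e ⬝ᵥ (X *ᵥ (b - βstar))) + l2norm (X *ᵥ (b - βstar)) ^ 2 := by
  rw [← l2norm_sub_sq]
  congr 2
  rw [Matrix.mulVec_sub]
  abel

theorem card_vecSupport_sub_le (b c : Fin p → ℝ) :
    (vecSupport (b - c)).card ≤ (vecSupport b).card + (vecSupport c).card :=
  (Finset.card_le_card (vecSupport_sub_subset Finset.subset_union_left
    Finset.subset_union_right)).trans (Finset.card_union_le _ _)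

theorem IsHTPOutput.card_vecSupport_le {y : Fin n → ℝ} {s : ℕ} {out : Fin p → ℝ}
    (h : IsHTPOutput X y s out) : (vecSupport out).card ≤ s := by
  obtain ⟨T, hT, hls⟩ := h.exists_isLeastSquares
  exact (Finset.card_le_card hls.1).trans hT

/-- Goodness of fit of Hard Thresholding Pursuit with the true model size. -/
theorem IsHTPOutput.sq_residual_le (hX : RIP X (3 * r) δ) (hδ : δ < 0.3478) (hδ0 : 0 ≤ δ)
    (hn : 0 < n) (hr : r ≤ p) (hR : 0 ≤ R)
    (hnoise : ∀ v : Fin p → ℝ, (vecSupport v).card ≤ 3 * r →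
      |e ⬝ᵥ (X *ᵥ v)| ≤ R * l2norm (X *ᵥ v))
    (hβ : (vecSupport βstar).card ≤ r) {out : Fin p → ℝ}
    (h : IsHTPOutput X (X *ᵥ βstar + e) r out) :
    l2norm (X *ᵥ βstar + e - X *ᵥ out) ^ 2 ≤ l2norm e ^ 2 + 960 * R ^ 2 := by
  have hn' : (0 : ℝ) < n := by exact_mod_cast hn
  have hupper : ∀ v : Fin p → ℝ, (vecSupport v).card ≤ 3 * r →
      l2norm (X *ᵥ v) ≤ √(1.35 * n) * l2norm v := by
    intro v hv
    refine (abs_le_of_sq_le_sq' ?_ (mul_nonneg (Real.sqrt_nonneg _) (l2norm_nonneg _))).2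
    rw [mul_pow, Real.sq_sqrt (by positivity)]
    have := (hX _ hv v le_rfl).2
    have h0 : 0 ≤ n * l2norm v ^ 2 := by positivity
    nlinarith
  set ε := R * √(1.35 * n) / n with hε
  have hε0 : 0 ≤ ε := by positivity
  have hnoise' : ∀ v : Fin p → ℝ, (vecSupport v).card ≤ 3 * r →
      e ⬝ᵥ (X *ᵥ v) ≤ n * (ε * l2norm v) := by
    intro v hv
    have h1 := (le_abs_self _).trans (hnoise v hv)
    have h2 := mul_le_mul_of_nonneg_left (hupper v hv) hR
    have h3 : n * (ε * l2norm v) = R * (√(1.35 * n) * l2norm v) := by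
      rw [hε]
      field_simp
    linarith
  have herr := h.l2norm_error_le hX hδ hδ0 hn hr hε0 hnoise' hβ
  have hcard : (vecSupport (out - βstar)).card ≤ 3 * r := by
    have := card_vecSupport_sub_le out βstar
    have := h.card_vecSupport_le
    omega
  set z := l2norm (X *ᵥ (out - βstar)) with hz
  -- 17 · 1.35 = 22.95. Then z² + 2Rz ≤ 575R², below the stated 960R².
  have hz1 : z ≤ 23 * R := by
    have h1 := (hupper _ hcard).trans (mul_le_mul_of_nonneg_left herr (Real.sqrt_nonneg _))
    have h2 : √(1.35 * n) * (17 * ε) = 22.95 * R := by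
      have h3 : √(1.35 * n) * √(1.35 * n) = 1.35 * n := Real.mul_self_sqrt (by positivity)
      calc √(1.35 * n) * (17 * ε) = 17 * R * (√(1.35 * n) * √(1.35 * n)) / n := by
            rw [hε]; ring
        _ = 22.95 * R := by
            rw [h3]
            field_simp
            ring
    rw [h2] at h1
    linarith
  have hz0 : 0 ≤ z := l2norm_nonneg _
  have hin := (abs_le.1 (hnoise _ hcard)).1
  rw [sq_residual_eq, ← hz]
  rw [← hz] at hin
  nlinarith

/-- Completing the square: z² - 2Rz ≥ -R². No isometry enters, so order 3s* suffices for the design.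
-/
theorem sq_residual_ge {k : ℕ} (hnoise : ∀ v : Fin p → ℝ, (vecSupport v).card ≤ k →
      |e ⬝ᵥ (X *ᵥ v)| ≤ R * l2norm (X *ᵥ v)) {b : Fin p → ℝ}
    (hb : (vecSupport b).card + (vecSupport βstar).card ≤ k) :
    l2norm e ^ 2 - R ^ 2 ≤ l2norm (X *ᵥ βstar + e - X *ᵥ b) ^ 2 := by
  have h1 := (abs_le.1 (hnoise _ ((card_vecSupport_sub_le b βstar).trans hb))).2
  rw [sq_residual_eq]
  nlinarith [sq_nonneg (R - l2norm (X *ᵥ (b - βstar)))]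

/-- A penalty of at least `K x / 10` cannot be compensated by overfitting of order `x`. -/
theorem not_le_mul_exp_neg_of_large_penalty {κ K x N A B : ℝ} (hκ : 0 < κ) (hx : 0 < x)
    (hA : 0 ≤ A) (hB : 0 ≤ B) (hN : κ / 2 ≤ N) (hAx : A * x ≤ κ / 4)
    (hK : 50 * (A + B) < κ * K) : ¬ N - A * x ≤ (N + B * x) * Real.exp (-(0.1 * K * x)) := by
  intro h
  have hK0 : 0 < K := by
    by_contra hK0
    nlinarith
  have hz : 0 < 0.1 * K * x := by positivity
  -- Clearing this denominator and dividing by `x` leaves `κK/40 ≤ A + B`.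
  have h1 : Real.exp (-(0.1 * K * x)) ≤ (1 + 0.1 * K * x)⁻¹ := by
    rw [Real.exp_neg]
    exact inv_anti₀ (by positivity) (by linarith [Real.add_one_le_exp (0.1 * K * x)])
  have h2 := h.trans (mul_le_mul_of_nonneg_left h1 (by nlinarith))
  rw [← div_eq_mul_inv, le_div_iff₀ (by positivity)] at h2
  have h3 : x * (0.1 * K * (N - A * x)) ≤ x * (A + B) := by linarith
  have h4 := le_of_mul_le_mul_left h3 hx
  have h5 : 0.1 * K * (κ / 4) ≤ 0.1 * K * (N - A * x) :=
    mul_le_mul_of_nonneg_left (by linarith) (by positivity)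
  nlinarith

end Selection

/-- On the noise event the information criterion selects a model of size at most `2 sstar`
and the selected estimate attains the rate of the true model size. -/
theorem selection_of_noise_bounds {κ K : ℝ} (hκ : 0 < κ) (hK : 50 * (1024 + 983040) / κ < K)
    {n p sstar smax : ℕ} {X : Matrix (Fin n) (Fin p) ℝ} {βstar : Fin p → ℝ} {δ σ : ℝ}
    {e : Fin n → ℝ} {βhat : ℕ → Fin p → ℝ} {shat : ℕ} (hs1 : 1 ≤ sstar) (hsm : sstar ≤ smax)
    (hp : 3 * smax ≤ p) (hβ : (vecSupport βstar).card ≤ sstar) (hσ : 0 < σ)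
    (hn : (4096 / κ + 1) * modelComplexity p smax ≤ n) (hX : RIP X (3 * sstar) δ)
    (hδ : δ < 0.3478)
    (hout : ∀ s ∈ Finset.Icc 1 smax, IsHTPOutput X (X *ᵥ βstar + e) s (βhat s))
    (hmem : shat ∈ Finset.Icc 1 smax)
    (hmin : infoCrit X (X *ᵥ βstar + e) K shat (βhat shat) ≤
      infoCrit X (X *ᵥ βstar + e) K sstar (βhat sstar))
    (hlower : κ / 2 * n * σ ^ 2 ≤ l2norm e ^ 2) (hupper : l2norm e ^ 2 ≤ 12 * n * σ ^ 2)
    (hnoise : ∀ s, sstar ≤ s → s ≤ smax → ∀ v : Fin p → ℝ, (vecSupport v).card ≤ 3 * s →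
      |e ⬝ᵥ (X *ᵥ v)| ≤ (32 * σ * √(modelComplexity p s)) * l2norm (X *ᵥ v)) :
    shat ≤ 2 * sstar ∧ l2norm (βhat shat - βstar) ≤
      √(8192 + 4 * (12 * K + 983040) * Real.exp K) * σ *
        √(modelComplexity p sstar / n) := by
  have hK0 : 0 < K := lt_trans (by positivity) hK
  obtain ⟨hm1, hm2⟩ := Finset.mem_Icc.1 hmem
  set f := modelComplexity p with hf
  have hfs : (sstar : ℝ) ≤ f sstar := le_modelComplexity hs1 (by omega)
  have hfpos : 0 < f sstar := lt_of_lt_of_le (by exact_mod_cast hs1) hfs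
  have hfm : f sstar ≤ f smax := modelComplexity_mono hs1 hsm hp
  have hfh : f shat ≤ f smax := modelComplexity_mono hm1 hm2 hp
  have hfh0 : 0 ≤ f shat := (Nat.cast_nonneg _).trans (le_modelComplexity hm1 (by omega))
  have hnm : f smax ≤ n := by
    have : 0 ≤ 4096 / κ * f smax := mul_nonneg (by positivity) (hfpos.le.trans hfm)
    linarith
  have hn' : (0 : ℝ) < n := by linarith
  have hn0 : 0 < n := by exact_mod_cast hn'
  have hδ0 : 0 ≤ δ := hX.nonneg (by omega) hn0 (by omega)
  have hRsq : ∀ s, 0 ≤ f s → (32 * σ * √(f s)) ^ 2 = 1024 * σ ^ 2 * f s := by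
    intro s hs
    rw [mul_pow, mul_pow, Real.sq_sqrt hs]
    norm_num
  have hfit := (hout sstar (Finset.mem_Icc.2 ⟨hs1, hsm⟩)).sq_residual_le hX hδ hδ0 hn0 (by omega)
    (by positivity) (hnoise sstar le_rfl hsm) hβ
  rw [hRsq _ hfpos.le] at hfit
  have hcrit := sq_residual_le_of_infoCrit_le hn0 hmin
  have hcardhat := (hout shat hmem).card_vecSupport_le
  have hshat : shat ≤ 2 * sstar := by
    by_contra hlt
    have hcmp : f sstar ≤ 0.9 * f shat :=
      modelComplexity_le_of_two_mul_le hs1 (by omega) (by omega)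
    have hlow := sq_residual_ge (hnoise shat (by omega) hm2) (b := βhat shat) (βstar := βstar)
      (by omega)
    rw [hRsq _ hfh0] at hlow
    have hposh : 0 < f shat := by linarith
    refine not_le_mul_exp_neg_of_large_penalty (κ := κ) (K := K) (x := f shat / n)
      (N := l2norm e ^ 2 / (n * σ ^ 2)) (A := 1024) (B := 983040) hκ (by positivity)
      (by norm_num) (by norm_num) ?_ ?_ ?_ ?_
    · rw [le_div_iff₀ (by positivity)]
      linarith
    · rw [← mul_div_assoc, div_le_iff₀ hn']
      have h1 : (4096 / κ + 1) * f shat ≤ n :=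
        (mul_le_mul_of_nonneg_left hfh (by positivity)).trans hn
      have h2 : κ / 4 * ((4096 / κ + 1) * f shat) = 1024 * f shat + κ / 4 * f shat := by
        field_simp
        ring
      have h3 := mul_le_mul_of_nonneg_left h1 (by positivity : 0 ≤ κ / 4)
      have h4 : 0 ≤ κ / 4 * f shat := by positivity
      linarith
    · rw [div_lt_iff₀ hκ] at hK
      linarith
    · have hexp : Real.exp (K / n * (f sstar - f shat)) ≤
          Real.exp (-(0.1 * K * (f shat / n))) := by
        rw [Real.exp_le_exp]
        have h1 : K / n * (f sstar - f shat) ≤ K / n * (-(0.1 * f shat)) :=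
          mul_le_mul_of_nonneg_left (by linarith) (by positivity)
        refine h1.trans (le_of_eq ?_)
        ring
      have h2 : l2norm e ^ 2 - 1024 * σ ^ 2 * f shat ≤
          (l2norm e ^ 2 + 983040 * σ ^ 2 * f shat) * Real.exp (-(0.1 * K * (f shat / n))) := by
        refine hlow.trans (hcrit.trans (mul_le_mul ?_ hexp (Real.exp_pos _).le (by positivity)))
        refine hfit.trans ?_
        have : σ ^ 2 * f sstar ≤ σ ^ 2 * f shat :=
          mul_le_mul_of_nonneg_left (by linarith) (by positivity)
        linarith
      have hc : 0 < n * σ ^ 2 := by positivity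
      have e1 : l2norm e ^ 2 / (n * σ ^ 2) - 1024 * (f shat / n) =
          (l2norm e ^ 2 - 1024 * σ ^ 2 * f shat) / (n * σ ^ 2) := by
        field_simp
      have e2 : (l2norm e ^ 2 / (n * σ ^ 2) + 983040 * (f shat / n)) =
          (l2norm e ^ 2 + 983040 * σ ^ 2 * f shat) / (n * σ ^ 2) := by
        field_simp
      rw [e1, e2, div_mul_eq_mul_div]
      exact div_le_div_of_nonneg_right h2 hc.le
  refine ⟨hshat, ?_⟩
  have hcard : (vecSupport (βhat shat - βstar)).card ≤ 3 * sstar := by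
    have := card_vecSupport_sub_le (βhat shat) βstar
    omega
  set q := f sstar / n with hq
  have hq0 : 0 < q := by positivity
  have hq1 : q ≤ 1 := by
    rw [hq, div_le_one hn']
    linarith
  have hqn : f sstar = q * n := by rw [hq]; field_simp
  have hexp1 : Real.exp (K / n * (f sstar - f shat)) ≤ Real.exp (K * q) := by
    rw [Real.exp_le_exp]
    have h1 : K / n * (f sstar - f shat) ≤ K / n * f sstar :=
      mul_le_mul_of_nonneg_left (by linarith) (by positivity)
    refine h1.trans (le_of_eq ?_)
    rw [hq]
    ring
  have hexp2 : Real.exp (K * q) ≤ Real.exp K :=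
    Real.exp_le_exp.2 (mul_le_of_le_one_right hK0.le hq1)
  have hexp3 : Real.exp (K * q) ≤ 1 + K * q * Real.exp K := by
    have h1 := Real.add_one_le_exp (-(K * q))
    have h2 : Real.exp (K * q) * Real.exp (-(K * q)) = 1 := by
      rw [← Real.exp_add]
      simp
    have h3 : Real.exp (K * q) * (1 - K * q) ≤ 1 := by
      rw [← h2]
      exact mul_le_mul_of_nonneg_left (by linarith) (Real.exp_pos _).le
    have h4 : K * q * Real.exp (K * q) ≤ K * q * Real.exp K :=
      mul_le_mul_of_nonneg_left hexp2 (by positivity)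
    linarith
  set z := l2norm (X *ᵥ (βhat shat - βstar)) with hz
  set R := 32 * σ * √(f sstar) with hR
  have hin := (abs_le.1 (hnoise sstar le_rfl hsm _ hcard)).2
  have hRsq' : R ^ 2 = 1024 * σ ^ 2 * (q * n) := by rw [hR, hRsq _ hfpos.le, hqn]
  have hz2 : z ^ 2 ≤ (4096 + 2 * (12 * K + 983040) * Real.exp K) * (σ ^ 2 * (q * n)) := by
    have h1 := hcrit.trans (mul_le_mul_of_nonneg_left hexp1 (sq_nonneg _))
    have h2 := h1.trans (mul_le_mul_of_nonneg_right hfit (Real.exp_pos _).le)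
    rw [sq_residual_eq, ← hz, hqn] at h2
    have h3 : l2norm e ^ 2 * Real.exp (K * q) ≤
        l2norm e ^ 2 + 12 * n * σ ^ 2 * (K * q * Real.exp K) := by
      have h4 := mul_le_mul_of_nonneg_left hexp3 (sq_nonneg (l2norm e))
      have h5 := mul_le_mul_of_nonneg_right hupper (by positivity : 0 ≤ K * q * Real.exp K)
      linarith
    have h6 : 983040 * (σ ^ 2 * (q * n)) * Real.exp (K * q) ≤
        983040 * (σ ^ 2 * (q * n)) * Real.exp K :=
      mul_le_mul_of_nonneg_left hexp2 (by positivity)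
    nlinarith [sq_nonneg (z - 2 * R)]
  have hrip := (hX _ hcard _ le_rfl).1
  rw [← hz] at hrip
  set D := l2norm (βhat shat - βstar) with hD
  have hD2 : D ^ 2 ≤ (8192 + 4 * (12 * K + 983040) * Real.exp K) * (σ ^ 2 * q) := by
    have h1 : n * D ^ 2 ≤ 2 * z ^ 2 := by
      have : 0 ≤ n * D ^ 2 := by positivity
      nlinarith
    refine le_of_mul_le_mul_left ?_ hn'
    linarith
  refine (abs_le_of_sq_le_sq' ?_ (by positivity)).2
  rw [mul_pow, mul_pow, Real.sq_sqrt (by positivity), Real.sq_sqrt hq0.le]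
  linarith

/-- The constants depend on nothing but the lower bound `κ` on the ratio of the variance of the noise
to its sub-Gaussian parameter `σ²` (`κ = 1` when `σ²` is the variance) and, for `C₁, C₂, C₃`, on the
tuning constant `K` of the criterion. -/
theorem theorem2 (κ : ℝ) (hκ : 0 < κ) :
    ∃ K₀ > (0 : ℝ), ∃ C₀ > (0 : ℝ), ∀ K ≥ K₀,
    ∃ C₁ > (0 : ℝ), ∃ C₂ > (0 : ℝ), ∃ C₃ > (0 : ℝ),
    ∀ (n p sstar smax : ℕ) (X : Matrix (Fin n) (Fin p) ℝ) (βstar : Fin p → ℝ) (δ σ : ℝ)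
      (Ω : Type*) [MeasurableSpace Ω] (μ : Measure Ω) [IsProbabilityMeasure μ]
      (ξ : Fin n → Ω → ℝ) (βhat : ℕ → Ω → Fin p → ℝ) (shat : Ω → ℕ),
      -- sparsity levels
      1 ≤ sstar → sstar ≤ smax → 3 * smax ≤ p →
      (vecSupport βstar).card ≤ sstar →
      -- i.i.d. centred sub-Gaussian errors at noise level `σ`
      0 < σ →
      (∀ i, Measurable (ξ i)) → iIndepFun ξ μ → (∀ i j, IdentDistrib (ξ i) (ξ j) μ μ) →
      (∀ i, ∫ ω, ξ i ω ∂μ = 0) →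
      (∀ i, ∀ t : ℝ, 0 ≤ t →
        μ.real {ω | t < |ξ i ω|} ≤ 2 * Real.exp (-(t ^ 2 / (2 * σ ^ 2)))) →
      (∀ i, κ * σ ^ 2 ≤ variance (ξ i) μ) →
      -- sample size and design
      C₀ * (smax * Real.log ((p : ℝ) / smax)) ≤ n →
      RIP X (3 * sstar) δ → δ < 0.3478 →
      -- HTP with data `y = X β* + ξ` for every model size in `[smax]`
      (∀ ω, ∀ s ∈ Finset.Icc 1 smax,
        IsHTPOutput X (X *ᵥ βstar + fun i => ξ i ω) s (βhat s ω)) →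
      -- the selected model size minimizes the information criterion
      (∀ ω, shat ω ∈ Finset.Icc 1 smax ∧ ∀ s ∈ Finset.Icc 1 smax,
        infoCrit X (X *ᵥ βstar + fun i => ξ i ω) K (shat ω) (βhat (shat ω) ω) ≤
          infoCrit X (X *ᵥ βstar + fun i => ξ i ω) K s (βhat s ω)) →
      ∃ E : Set Ω, MeasurableSet E ∧
        1 - C₂ * Real.exp (-(C₃ * (sstar * Real.log ((p : ℝ) / sstar)))) ≤ μ.real E ∧
        ∀ ω ∈ E, shat ω ≤ 2 * sstar ∧
          l2norm (βhat (shat ω) ω - βstar) ≤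
            C₁ * σ * √(sstar * Real.log ((p : ℝ) / sstar) / n) := by
  set q₀ : ℝ := (1 - Real.exp (1 - Real.log 3))⁻¹ with hq₀
  have hq₀pos : 0 < q₀ :=
    inv_pos.2 (sub_pos.2 (Real.exp_lt_one_iff.2 (by linarith [Real.one_lt_log_three])))
  refine ⟨50 * (1024 + 983040) / κ + 1, by positivity, 4096 / κ + 1, by positivity, fun K hK => ?_⟩
  have hK0 : 0 < K := lt_of_lt_of_le (by positivity) hK
  refine ⟨√(8192 + 4 * (12 * K + 983040) * Real.exp K), by positivity, q₀ + 2, by positivity,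
    min 1 (κ ^ 2 / 768), by positivity, ?_⟩
  intro n p sstar smax X βstar δ σ Ω _ μ _ ξ βhat shat hs1 hsm hp hβ hσ hmeas hind _ hmean htail
    hvar hn hX hδ hout hmin
  set c := min 1 (κ ^ 2 / 768) with hc
  set f := modelComplexity p sstar with hf
  have hfs : (sstar : ℝ) ≤ f := le_modelComplexity hs1 (by omega)
  have hf0 : 0 ≤ f := (Nat.cast_nonneg _).trans hfs
  have hfn : f ≤ n := by
    have h1 : f ≤ modelComplexity p smax := modelComplexity_mono hs1 hsm hp
    have h2 : 0 ≤ 4096 / κ * modelComplexity p smax := mul_nonneg (by positivity) (hf0.trans h1)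
    have h3 : (4096 / κ + 1) * modelComplexity p smax ≤ n := hn
    linarith
  obtain ⟨N, hNm, hNprob, hN⟩ := exists_uniform_noise_event X hσ hmeas hind hmean htail hs1 hp
  set U : Set Ω := {ω | 12 * n * σ ^ 2 ≤ l2norm (fun i => ξ i ω) ^ 2} with hU
  set V : Set Ω := {ω | l2norm (fun i => ξ i ω) ^ 2 ≤ κ / 2 * n * σ ^ 2} with hV
  have hnormm : Measurable fun ω => l2norm (fun i => ξ i ω) ^ 2 := by
    simp only [l2norm_sq, dotProduct]
    fun_prop
  have hUm : MeasurableSet U := measurableSet_le measurable_const hnormm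
  have hVm : MeasurableSet V := measurableSet_le hnormm measurable_const
  have hUprob := measureReal_noise_norm_ge_le (μ := μ) hσ hmeas hind htail
  have hVprob := measureReal_noise_norm_le_le (μ := μ) hκ hσ hmeas hind hmean htail hvar
  have hm : MeasurableSet (N ∪ (U ∪ V)) := hNm.union (hUm.union hVm)
  refine ⟨(N ∪ (U ∪ V))ᶜ, hm.compl, ?_, fun ω hω => ?_⟩
  · rw [probReal_compl_eq_one_sub hm]
    have h1 : μ.real (N ∪ (U ∪ V)) ≤ μ.real N + (μ.real U + μ.real V) :=
      (measureReal_union_le _ _).trans (add_le_add_right (measureReal_union_le _ _) _)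
    have h2 : Real.exp (-f) ≤ Real.exp (-(c * f)) :=
      Real.exp_le_exp.2 (neg_le_neg (mul_le_of_le_one_left hf0 (min_le_left _ _)))
    have h3 : Real.exp (-(n : ℝ)) ≤ Real.exp (-(c * f)) :=
      (Real.exp_le_exp.2 (neg_le_neg hfn)).trans h2
    have h4 : Real.exp (-(κ ^ 2 / 768 * n)) ≤ Real.exp (-(c * f)) :=
      Real.exp_le_exp.2 (neg_le_neg (mul_le_mul (min_le_right _ _) hfn hf0 (by positivity)))
    have h5 := mul_le_mul_of_nonneg_left h2 hq₀pos.le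
    have h6 : μ.real (N ∪ (U ∪ V)) ≤ (q₀ + 2) * Real.exp (-(c * f)) := by linarith
    exact sub_le_sub_left h6 1
  · simp only [Set.mem_compl_iff, Set.mem_union, not_or] at hω
    obtain ⟨hωN, hωU, hωV⟩ := hω
    exact selection_of_noise_bounds (e := fun i => ξ i ω) (βhat := fun s => βhat s ω)
      (shat := shat ω) hκ (by linarith) hs1 hsm hp hβ hσ hn hX hδ
      (hout ω) (hmin ω).1 ((hmin ω).2 sstar (Finset.mem_Icc.2 ⟨hs1, hsm⟩)) (not_le.1 hωV).le
      (not_le.1 hωU).le (hN ω hωN)
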